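/- **Setting.** Fix $n\in\{1,2,\dots\}\cup\{\infty\}$. Manifolds are finite-dimensional, of class $C^n$, without boundary; no separation or countability axiom is assumed. *Cartesian closure.* Let $\mathcal F$ be a category of topological spaces and continuous maps that contains constant maps and open subspaces with their inclusions, and is closed under restriction to open subspaces and under gluing of maps along open covers. An object of $\overline{\mathcal F}$ is a set $X$ with, for each $H\in\mathcal F$, a set of maps $H\to X$ ("figures of type $H$") containing the constants, stable under precomposition with arrows of $\mathcal F$, and local on $H$. Arrows are the maps taking figures to figures. Each $K\in\mathcal F$ gives $\bar K\in\overline{\mathcal F}$ whose figures are the $\mathcal F$-arrows into $K$. Products have componentwise figures. The exponential $Y^X$ is the set of arrows $X\to Y$, where $d:H\to Y^X$ is a figure iff $(h,x)\mapsto d(h)(x)$ is an arrow $\bar H\times X\to Y$. Each space carries the final topology of its figures. *$C^n$ spaces.* They are the objects of $\overline{\mathcal F}$ for $\mathcal F$ the category of open subsets of the spaces $\mathbb R^m$ with $C^n$ maps. A manifold $M$ is a $C^n$ space whose figures are the $C^n$ maps $H\to M$. An observable of a $C^n$ space $X$ is an arrow $\varphi:U\to\bar K$, with $U\subseteq X$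 open with the induced figures and $K$ open in some $\mathbb R^k$. A path $x:\mathbb R\to X$ continuous at $0$ is nilpotent if for every observable $\varphi$ with $x_0\in U$ there is $j\in\mathbb N$ with $\|\varphi(x_t)-\varphi(x_0)\|^j=o(t)$ as $t\to0$. Two nilpotent paths $x,y$ are equivalent if for every observable $\varphi:U\to\bar K$ one has $x_0\in U\Leftrightarrow y_0\in U$ and, in this case, $\varphi(x_t)=\varphi(y_t)+o(t)$. Write ${}^\bullet X$ for the set of classes, and ${}^\bullet f[x]=[f\circ x]$ for an arrow $f$. *Extended spaces.* They are the objects of $\overline{\mathcal F}$ for the following $\mathcal F$. Its objects are the subsets $S\subseteq{}^\bullet(\mathbb R^s)$, $s\in\mathbb N$, with the topology generated by the sets ${}^\bullet U\cap S$, $U\subseteq\mathbb R^s$ open. Its arrows $f:S\to T\subseteq{}^\bullet(\mathbb R^t)$ are the maps that near each point of $S$ have the form $f(x)={}^\bullet g\langle p,x\rangle$ for all $x\in{}^\bullet V\cap S$, with $p\in{}^\bullet U\subseteq{}^\bullet(\mathbb R^m)$, $U\subseteq\mathbb R^m$ and $V\subseteq\mathbb R^s$ open, $g\in C^n(U\times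 V,\mathbb R^t)$, and $\langle[a],[b]\rangle=[(a,b)]$. For $Z\subseteq{}^\bullet X$, the extended space induced on $Z$ by $X$ has as figures the maps that are locally the composite of an arrow of $\mathcal F$ with a map $T\to Z$ that is either constant or ${}^\bullet h|_T$, for a figure $h:V\to X$ with $T\subseteq{}^\bullet V$. In this way ${}^\bullet X$ is an extended space, and so is $D=\{h\in{}^\bullet\mathbb R : h(t)=O(t)\}$ (induced by $\mathbb R$). *Infinitesimal linearity.* An extended space $X$ is infinitesimally linear if for every integer $k>1$, every $x\in X$ and all arrows $t_1,\dots,t_k:D\to X$ with $t_i(0)=x$, there is exactly one arrow $p:D^k\to X$ with $$p(\underbrace{0,\dots,0}_{i-1},h,0,\dots,0)=t_i(h)\qquad\text{for all } i=1,\dots,k \text{ and all } h\in D .$$ **Theorem.** For every manifold $M$, the extended space ${}^\bullet M$ is infinitesimally linear. If $M_1,\dots,M_s$ ($s\ge2$) are manifolds, then the iterated exponential and the exponential of the product are isomorphic, $$\Bigl(\cdots\bigl({}^\bullet M_1^{\ {}^\bullet M_2}\bigr)^{{}^\bullet M_3}\cdots\Bigr)^{{}^\bullet M_s}\;\cong\;{}^\bullet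 M_1^{\ {}^\bullet(M_2\times\cdots\times M_s)},$$ by an isomorphism of extended spaces sending $F$ to the map $z\mapsto F(m_s)\cdots(m_3)(m_2)$, where $m_i\in{}^\bullet M_i$ are the projections of $z$; and both sides are infinitesimally linear. -/

import Mathlib

open Set Filter Topology Asymptotics
open scoped Manifold ContDiff

universe u v

namespace IDG

/-! ## Types of figures and the cartesian closure -/

/-- A category of types of figures: a subcategory of `Top` that contains the constant maps and the
open subspaces of its objects with their inclusions, is closed under restriction of maps to open
subspaces, and has the sheaf property. `carrier H` is the support set `|H|`, `IsMor f` says that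
`f` is an arrow, `restr H U` is the open subspace `(U ≺ H)` and `incl H U` its inclusion. -/
structure FigCat where
  Obj : Type
  carrier : Obj → Type
  top : ∀ H, TopologicalSpace (carrier H)
  IsMor : ∀ {H K : Obj}, (carrier H → carrier K) → Prop
  restr : ∀ H : Obj, TopologicalSpace.Opens (carrier H) → Obj
  incl : ∀ (H : Obj) (U : TopologicalSpace.Opens (carrier H)), carrier (restr H U) → carrier H
  incl_isOpenEmbedding : ∀ H U, IsOpenEmbedding (incl H U)
  range_incl : ∀ H U, range (incl H U) = (U : Set (carrier H))
  continuous_of_isMor : ∀ {H K : Obj} {f : carrier H → carrier K}, IsMor f → Continuous f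
  isMor_id : ∀ H : Obj, IsMor (id : carrier H → carrier H)
  isMor_comp : ∀ {H J K : Obj} {g : carrier J → carrier K} {f : carrier H → carrier J},
    IsMor g → IsMor f → IsMor (g ∘ f)
  isMor_const : ∀ {H K : Obj} (k : carrier K), IsMor (fun _ : carrier H => k)
  isMor_incl : ∀ H U, IsMor (incl H U)
  isMor_lift : ∀ {H K : Obj} {V : TopologicalSpace.Opens (carrier K)}
    {f : carrier H → carrier (restr K V)}, IsMor (incl K V ∘ f) → IsMor f
  isMor_sheaf : ∀ {H K : Obj} {f : carrier H → carrier K},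
    (∀ h, ∃ U : TopologicalSpace.Opens (carrier H), h ∈ U ∧ IsMor (f ∘ incl H U)) → IsMor f

attribute [instance] FigCat.top

/-- Objects of the cartesian closure of `F`: a set with a family of figures, closed under
reparametrization, containing the constant maps, and of local character. -/
structure Space (F : FigCat) where
  carrier : Type u
  fig : ∀ H : F.Obj, (F.carrier H → carrier) → Prop
  fig_comp : ∀ {J H : F.Obj} {f : F.carrier J → F.carrier H} {d : F.carrier H → carrier},
    F.IsMor f → fig H d → fig J (d ∘ f)
  fig_const : ∀ (H : F.Obj) (x : carrier), fig H (fun _ => x)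
  fig_sheaf : ∀ (H : F.Obj) (d : F.carrier H → carrier),
    (∀ h, ∃ U : TopologicalSpace.Opens (F.carrier H), h ∈ U ∧ fig (F.restr H U) (d ∘ F.incl H U)) →
      fig H d

variable {F : FigCat}

/-- Arrows of the cartesian closure: maps that take figures to figures. -/
def Space.IsHom (X Y : Space F) (f : X.carrier → Y.carrier) : Prop :=
  ∀ (H : F.Obj) (d : F.carrier H → X.carrier), X.fig H d → Y.fig H (f ∘ d)

/-- The set of arrows `X → Y`. -/
def Space.Hom (X Y : Space F) : Type _ := {f : X.carrier → Y.carrier // X.IsHom Y f}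

instance (X Y : Space F) : CoeFun (X.Hom Y) (fun _ => X.carrier → Y.carrier) := ⟨Subtype.val⟩

/-- Composition of arrows. -/
def Space.Hom.comp {X Y Z : Space F} (g : Y.Hom Z) (f : X.Hom Y) : X.Hom Z :=
  ⟨fun x => g (f x), fun H d hd => g.2 H _ (f.2 H d hd)⟩

/-- Isomorphisms of the cartesian closure. -/
structure Space.Iso (X Y : Space F) where
  hom : X.Hom Y
  inv : Y.Hom X
  hom_inv : ∀ y, hom (inv y) = y
  inv_hom : ∀ x, inv (hom x) = x

/-- The final topology with respect to all figures. -/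
@[reducible] def Space.topology (X : Space F) : TopologicalSpace X.carrier where
  IsOpen U := ∀ (H : F.Obj) (d : F.carrier H → X.carrier), X.fig H d → IsOpen (d ⁻¹' U)
  isOpen_univ := fun _ _ _ => isOpen_univ
  isOpen_inter := fun _ _ hU hV H d hd => (hU H d hd).inter (hV H d hd)
  isOpen_sUnion := fun S hS H d hd => by
    rw [preimage_sUnion]
    exact isOpen_biUnion fun U hU => hS U hU H d hd

/-- The space `K̄` of an object `K` of `F`: its figures are the arrows of `F` into `K`. -/
def Space.bar (K : F.Obj) : Space F where
  carrier := F.carrier K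
  fig _ d := F.IsMor d
  fig_comp hf hd := F.isMor_comp hd hf
  fig_const _ x := F.isMor_const x
  fig_sheaf _ _ h := F.isMor_sheaf h

/-- The subspace `(S ≺ X)`. -/
def Space.sub (X : Space F) (S : Set X.carrier) : Space F where
  carrier := S
  fig H d := X.fig H (fun h => (d h : X.carrier))
  fig_comp hf hd := X.fig_comp hf hd
  fig_const H x := X.fig_const H x
  fig_sheaf H _ h := X.fig_sheaf H _ h

/-- The product of two spaces. -/
def Space.prod (X : Space.{u} F) (Y : Space F) : Space F where
  carrier := X.carrier × Y.carrier
  fig H d := X.fig H (fun h => (d h).1) ∧ Y.fig H (fun h => (d h).2)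
  fig_comp hf hd := ⟨X.fig_comp hf hd.1, Y.fig_comp hf hd.2⟩
  fig_const H x := ⟨X.fig_const H x.1, Y.fig_const H x.2⟩
  fig_sheaf H _ h := ⟨X.fig_sheaf H _ fun x => let ⟨U, hx, hU⟩ := h x; ⟨U, hx, hU.1⟩,
    Y.fig_sheaf H _ fun x => let ⟨U, hx, hU⟩ := h x; ⟨U, hx, hU.2⟩⟩

/-- The power `X^k` (a product of `k` copies of `X`). -/
def Space.pow (X : Space F) (k : ℕ) : Space F where
  carrier := Fin k → X.carrier
  fig H d := ∀ i, X.fig H (fun h => d h i)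
  fig_comp hf hd i := X.fig_comp hf (hd i)
  fig_const H x i := X.fig_const H (x i)
  fig_sheaf H _ h i := X.fig_sheaf H _ fun x => let ⟨U, hx, hU⟩ := h x; ⟨U, hx, hU i⟩

/-- The exponential object `Y^X`: the set of arrows `X → Y`; a map `d` into it is a figure of
type `H` iff `(h, x) ↦ d(h)(x)` is an arrow `H̄ × X → Y`. -/
def Space.exp (X Y : Space F) : Space F where
  carrier := X.Hom Y
  fig H d := ((Space.bar H).prod X).IsHom Y (fun z => d z.1 z.2)
  fig_comp {J H f d} hf hd K e he :=
    hd K (fun k => (f (e k).1, (e k).2)) ⟨F.isMor_comp hf he.1, he.2⟩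
  fig_const H x K e he := x.2 K _ he.2
  fig_sheaf H d h K e he := by
    refine Y.fig_sheaf K _ fun k => ?_
    obtain ⟨U, hU, hd⟩ := h (e k).1
    let e₁ : F.carrier K → F.carrier H := fun k => (e k).1
    have he₁ : F.IsMor e₁ := he.1
    let V : TopologicalSpace.Opens (F.carrier K) :=
      ⟨e₁ ⁻¹' U, U.2.preimage (F.continuous_of_isMor he₁)⟩
    refine ⟨V, hU, ?_⟩
    have hmem : ∀ x : F.carrier (F.restr K V), e₁ (F.incl K V x) ∈ range (F.incl H U) := by
      intro x
      have : F.incl K V x ∈ (V : Set (F.carrier K)) := by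
        rw [← F.range_incl K V]; exact mem_range_self x
      rw [F.range_incl]
      exact this
    choose φ hφ using hmem
    have hφm : F.IsMor φ := by
      apply F.isMor_lift
      have : F.incl H U ∘ φ = e₁ ∘ F.incl K V := funext hφ
      rw [this]
      exact F.isMor_comp he₁ (F.isMor_incl K V)
    have := hd (F.restr K V) (fun x => (φ x, (e (F.incl K V x)).2))
      ⟨hφm, X.fig_comp (F.isMor_incl K V) he.2⟩
    refine (congrArg (Y.fig _) (funext fun x => ?_)).mp this
    exact congrArg (fun y => (d y) (e (F.incl K V x)).2) (hφ x)

/-- The space generated on a set `X` by a family `D₀` of figures that contains the constant maps: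
its figures are the maps that locally are a map of `D₀` composed with an arrow of `F`. -/
def Space.gen (X : Type u) (D₀ : ∀ K : F.Obj, Set (F.carrier K → X))
    (hD₀ : ∀ K x, (fun _ => x) ∈ D₀ K) : Space F where
  carrier := X
  fig H δ := ∀ h, ∃ U : TopologicalSpace.Opens (F.carrier H), h ∈ U ∧ ∃ K, ∃ d ∈ D₀ K,
    ∃ f : F.carrier (F.restr H U) → F.carrier K, F.IsMor f ∧ δ ∘ F.incl H U = d ∘ f
  fig_comp {J H f δ} hf hδ j := by
    obtain ⟨U, hU, K, d, hd, g, hg, hgd⟩ := hδ (f j)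
    let V : TopologicalSpace.Opens (F.carrier J) :=
      ⟨f ⁻¹' U, U.2.preimage (F.continuous_of_isMor hf)⟩
    have hmem : ∀ x : F.carrier (F.restr J V), f (F.incl J V x) ∈ range (F.incl H U) := by
      intro x
      have : F.incl J V x ∈ (V : Set (F.carrier J)) := by
        rw [← F.range_incl J V]; exact mem_range_self x
      rw [F.range_incl]
      exact this
    choose φ hφ using hmem
    have hφm : F.IsMor φ := by
      apply F.isMor_lift
      have : F.incl H U ∘ φ = f ∘ F.incl J V := funext hφ
      rw [this]
      exact F.isMor_comp hf (F.isMor_incl J V)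
    refine ⟨V, hU, K, d, hd, g ∘ φ, F.isMor_comp hg hφm, funext fun x => ?_⟩
    have := congrFun hgd (φ x)
    simpa [hφ] using this
  fig_const H x h := ⟨⊤, trivial, H, _, hD₀ H x, F.incl H ⊤, F.isMor_incl H ⊤, rfl⟩
  fig_sheaf H δ hδ h := by
    obtain ⟨U, hU, hδU⟩ := hδ h
    obtain ⟨h', rfl⟩ : h ∈ range (F.incl H U) := by rw [F.range_incl]; exact hU
    obtain ⟨U', hU', K, d, hd, f, hf, hfd⟩ := hδU h'
    let V : TopologicalSpace.Opens (F.carrier H) :=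
      ⟨F.incl H U '' U', (F.incl_isOpenEmbedding H U).isOpenMap _ U'.2⟩
    have hmem : ∀ x : F.carrier (F.restr H V),
        ∃ y : F.carrier (F.restr (F.restr H U) U'), F.incl H U (F.incl _ U' y) = F.incl H V x := by
      intro x
      have : F.incl H V x ∈ (V : Set (F.carrier H)) := by
        rw [← F.range_incl H V]; exact mem_range_self x
      obtain ⟨y, hy, hyx⟩ := this
      have hy' : y ∈ range (F.incl _ U') := by rw [F.range_incl]; exact hy
      obtain ⟨z, rfl⟩ := hy'
      exact ⟨z, hyx⟩
    choose φ hφ using hmem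
    have hφm : F.IsMor φ := by
      apply F.isMor_lift
      apply F.isMor_lift
      have : F.incl H U ∘ (F.incl _ U' ∘ φ) = F.incl H V := funext hφ
      rw [this]
      exact F.isMor_incl H V
    refine ⟨V, ⟨h', hU', rfl⟩, K, d, hd, f ∘ φ, F.isMor_comp hf hφm, funext fun x => ?_⟩
    have := congrFun hfd (φ x)
    simpa [hφ] using this

/-! ## The category `Cⁿ` -/

lemma contMDiffAt_of_comp_incl {n : ℕ∞} {E M : Type*} [NormedAddCommGroup E] [NormedSpace ℝ E]
    [TopologicalSpace M] [ChartedSpace E M] {m : ℕ} {W W' : TopologicalSpace.Opens (Fin m → ℝ)}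
    {d : W → M} {i : W' → W} (hi : ∀ x, (i x : Fin m → ℝ) = x) {x : W'}
    (h : ContMDiffAt 𝓘(ℝ, Fin m → ℝ) 𝓘(ℝ, E) n (d ∘ i) x) :
    ContMDiffAt 𝓘(ℝ, Fin m → ℝ) 𝓘(ℝ, E) n d (i x) := by
  let g : (Fin m → ℝ) → M := Function.extend Subtype.val d (fun _ => d (i x))
  have hg : ∀ y : W, g y = d y := fun y => Subtype.val_injective.extend_apply d _ y
  have h1 : (fun y : W => g y) = d := funext hg
  have h2 : (fun y : W' => g y) = d ∘ i := funext fun y => by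
    rw [← hi y]; exact hg (i y)
  rw [← h2, contMDiffAt_subtype_iff] at h
  rw [← h1, contMDiffAt_subtype_iff, hi]
  exact h

lemma contMDiff_subtypeVal_comp_iff {n : ℕ∞} {m k : ℕ} {W : TopologicalSpace.Opens (Fin m → ℝ)}
    {K : TopologicalSpace.Opens (Fin k → ℝ)} {f : W → K} :
    ContMDiff 𝓘(ℝ, Fin m → ℝ) 𝓘(ℝ, Fin k → ℝ) n (fun x => (f x : Fin k → ℝ)) ↔
      ContMDiff 𝓘(ℝ, Fin m → ℝ) 𝓘(ℝ, Fin k → ℝ) n f :=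
  forall_congr' fun x => ChartedSpace.liftPropWithinAt_subtypeVal_comp_iff f univ x

/-- The open subset of `ℝᵐ` given by an open subset of an open subset of `ℝᵐ`. -/
def openImage {m : ℕ} (W : TopologicalSpace.Opens (Fin m → ℝ)) (U : TopologicalSpace.Opens W) :
    TopologicalSpace.Opens (Fin m → ℝ) :=
  ⟨Subtype.val '' (U : Set W), W.2.isOpenMap_subtype_val _ U.2⟩

/-- The inclusion of `openImage W U` in `W`. -/
def openImageIncl {m : ℕ} (W : TopologicalSpace.Opens (Fin m → ℝ))
    (U : TopologicalSpace.Opens W) (x : openImage W U) : W :=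
  ⟨x, by obtain ⟨y, _, hy⟩ := x.2; rw [← hy]; exact y.2⟩

/-- The open subsets of the spaces `ℝᵐ`, `m ∈ ℕ`. -/
abbrev ORObj := Σ m : ℕ, TopologicalSpace.Opens (Fin m → ℝ)

/-- The category with objects the open subsets of the spaces `ℝᵐ`, `m ∈ ℕ`, and arrows the maps
of class `Cⁿ`. -/
def OR (n : ℕ∞) : FigCat where
  Obj := ORObj
  carrier H := H.2
  top _ := inferInstance
  IsMor {H K} f := ContMDiff 𝓘(ℝ, Fin H.1 → ℝ) 𝓘(ℝ, Fin K.1 → ℝ) n f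
  restr H U := ⟨H.1, openImage H.2 U⟩
  incl H U := openImageIncl H.2 U
  incl_isOpenEmbedding H U :=
    .of_comp _ H.2.2.isOpenEmbedding_subtypeVal (openImage H.2 U).2.isOpenEmbedding_subtypeVal
  range_incl H U := by
    ext x
    constructor
    · rintro ⟨⟨_, y, hy, rfl⟩, rfl⟩
      exact hy
    · intro hx
      exact ⟨⟨x, x, hx, rfl⟩, rfl⟩
  continuous_of_isMor h := h.continuous
  isMor_id _ := contMDiff_id
  isMor_comp hg hf := hg.comp hf
  isMor_const _ := contMDiff_const
  isMor_incl H U := contMDiff_subtypeVal_comp_iff.1 contMDiff_subtype_val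
  isMor_lift {H K V f} h :=
    contMDiff_subtypeVal_comp_iff.1 (contMDiff_subtypeVal_comp_iff.2 h :)
  isMor_sheaf {H K f} h x := by
    obtain ⟨U, hx, hU⟩ := h x
    exact contMDiffAt_of_comp_incl (i := openImageIncl H.2 U) (fun _ => rfl)
      (hU (⟨x, x, hx, rfl⟩ : openImage H.2 U))

/-- An open subset of `ℝᵐ` as an object of `OR n`. -/
def OR.of (n : ℕ∞) {m : ℕ} (W : TopologicalSpace.Opens (Fin m → ℝ)) : (OR n).Obj :=
  (⟨m, W⟩ : ORObj)

/-- The category of `Cⁿ` spaces. -/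
abbrev CSpace (n : ℕ∞) := Space.{u} (OR n)

/-- A manifold of class `Cⁿ` (without boundary, of finite dimension). -/
structure Man (n : ℕ∞) where
  carrier : Type u
  E : Type
  [normedAddCommGroup : NormedAddCommGroup E]
  [normedSpace : NormedSpace ℝ E]
  [finiteDimensional : FiniteDimensional ℝ E]
  [topologicalSpace : TopologicalSpace carrier]
  [chartedSpace : ChartedSpace E carrier]
  [isManifold : IsManifold 𝓘(ℝ, E) n carrier]

attribute [instance] Man.normedAddCommGroup Man.normedSpace Man.finiteDimensional
  Man.topologicalSpace Man.chartedSpace Man.isManifold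

variable {n : ℕ∞}

/-- A map from an open subset of `ℝᵐ` to a manifold is of class `Cⁿ`. -/
def Man.IsFig (M : Man.{u} n) (H : ORObj) (d : H.2 → M.carrier) : Prop :=
  ContMDiff 𝓘(ℝ, Fin H.1 → ℝ) 𝓘(ℝ, M.E) n d

lemma Man.IsFig.comp (M : Man.{u} n) {J H : ORObj} {d : H.2 → M.carrier} (hd : M.IsFig H d)
    {f : J.2 → H.2} (hf : ContMDiff 𝓘(ℝ, Fin J.1 → ℝ) 𝓘(ℝ, Fin H.1 → ℝ) n f) :
    M.IsFig J (d ∘ f) :=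
  ContMDiff.comp hd hf

/-- The `Cⁿ` space of a manifold: its figures of type `H` are the maps `H → M` of class `Cⁿ`. -/
def Man.toCSpace (M : Man.{u} n) : CSpace.{u} n where
  carrier := M.carrier
  fig H d := M.IsFig H d
  fig_comp hf hd := hd.comp M hf
  fig_const (H : ORObj) x := (contMDiff_const : M.IsFig H fun _ => x)
  fig_sheaf (H : ORObj) d h := fun x : H.2 => by
    obtain ⟨U, hx, hU⟩ := h x
    exact contMDiffAt_of_comp_incl (i := openImageIncl H.2 U) (fun _ => rfl)
      (hU (⟨x, x, hx, rfl⟩ : openImage H.2 U))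

/-- The product of two manifolds. -/
noncomputable def Man.prod (M N : Man.{u} n) : Man.{u} n where
  carrier := M.carrier × N.carrier
  E := M.E × N.E
  chartedSpace := inferInstanceAs (ChartedSpace (ModelProd M.E N.E) (M.carrier × N.carrier))
  isManifold := by
    rw [modelWithCornersSelf_prod]
    exact inferInstanceAs (IsManifold (𝓘(ℝ, M.E).prod 𝓘(ℝ, N.E)) n (M.carrier × N.carrier))

/-- The product `M₁ × (M₂ × (… × Mₛ))` of a nonempty list of manifolds. -/
noncomputable def Man.listProd : Man.{u} n → List (Man.{u} n) → Man.{u} n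
  | M, [] => M
  | M, N :: L => M.prod (Man.listProd N L)

lemma Man.isFig_prod (M N : Man.{u} n) {H : ORObj} {d : H.2 → M.carrier × N.carrier}
    (h : (M.prod N).IsFig H d) :
    ContMDiff 𝓘(ℝ, Fin H.1 → ℝ) (𝓘(ℝ, M.E).prod 𝓘(ℝ, N.E)) n d := by
  rw [← modelWithCornersSelf_prod]
  exact h

/-- The first projection of a product of two manifolds, as an arrow of `Cⁿ`. -/
noncomputable def Man.fst (M N : Man.{u} n) : (M.prod N).toCSpace.Hom M.toCSpace :=
  ⟨fun z : M.carrier × N.carrier => z.1, fun _ _ hd =>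
    contMDiff_fst.comp (M.isFig_prod N hd)⟩

/-- The second projection of a product of two manifolds, as an arrow of `Cⁿ`. -/
noncomputable def Man.snd (M N : Man.{u} n) : (M.prod N).toCSpace.Hom N.toCSpace :=
  ⟨fun z : M.carrier × N.carrier => z.2, fun _ _ hd =>
    contMDiff_snd.comp (M.isFig_prod N hd)⟩

/-! ## Extension of `Cⁿ` spaces -/

/-- `c` is an observable on the zone `UK` of `X`: `U` is open in `X` and `c` restricts to an arrow
`(U ≺ X) → K̄`. (Only the values of `c` on `U` matter.) -/
def IsObservable (X : CSpace.{u} n) (U : Set X.carrier) {k : ℕ}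
    (K : TopologicalSpace.Opens (Fin k → ℝ)) (c : X.carrier → Fin k → ℝ) : Prop :=
  IsOpen[X.topology] U ∧
    ∃ φ : (X.sub U).Hom (Space.bar (OR.of n K)), ∀ u : U, c u = (φ u : K).1

/-- `x : ℝ → X` is continuous at `0` and nilpotent relative to `X`. -/
def IsNilpotentPath (X : CSpace.{u} n) (x : ℝ → X.carrier) : Prop :=
  Tendsto x (𝓝 0) (@nhds _ X.topology (x 0)) ∧
    ∀ (U : Set X.carrier) (k : ℕ) (K : TopologicalSpace.Opens (Fin k → ℝ))
      (c : X.carrier → Fin k → ℝ), IsObservable X U K c → x 0 ∈ U →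
        ∃ j : ℕ, (fun t => ‖c (x t) - c (x 0)‖ ^ j) =o[𝓝 0] (fun t : ℝ => t)

/-- The set of nilpotent paths of `X`. -/
def NilpotentPath (X : CSpace.{u} n) : Type u := {x : ℝ → X.carrier // IsNilpotentPath X x}

/-- Equality of nilpotent paths up to `o(t)`, tested by all observables. -/
def extSetoid (X : CSpace.{u} n) : Setoid (NilpotentPath X) where
  r x y := ∀ (U : Set X.carrier) (k : ℕ) (K : TopologicalSpace.Opens (Fin k → ℝ))
      (c : X.carrier → Fin k → ℝ), IsObservable X U K c →
        (x.1 0 ∈ U ↔ y.1 0 ∈ U) ∧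
          (x.1 0 ∈ U → (fun t => c (x.1 t) - c (y.1 t)) =o[𝓝 0] (fun t : ℝ => t))
  iseqv :=
    { refl := fun x U k K c _ => ⟨Iff.rfl, fun _ => by simp⟩
      symm := fun {x y} h U k K c hc => ⟨(h U k K c hc).1.symm, fun hy => by
        have := ((h U k K c hc).2 ((h U k K c hc).1.2 hy)).neg_left
        simpa using this⟩
      trans := fun {x y z} h h' U k K c hc =>
        ⟨(h U k K c hc).1.trans (h' U k K c hc).1, fun hx => by
          have := ((h U k K c hc).2 hx).add ((h' U k K c hc).2 ((h U k K c hc).1.1 hx))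
          simpa using this⟩ }

/-- The set of points of the extension of a `Cⁿ` space. -/
def Ext (X : CSpace.{u} n) : Type u := Quotient (extSetoid X)

/-- The class of a nilpotent path. -/
def Ext.mk {X : CSpace.{u} n} (x : NilpotentPath X) : Ext X := Quotient.mk (extSetoid X) x

lemma Space.Hom.isOpen_preimage {X : Space.{u} F} {Y : Space.{v} F} (f : X.Hom Y) {V : Set Y.carrier}
    (hV : IsOpen[Y.topology] V) : IsOpen[X.topology] (f.1 ⁻¹' V) :=
  fun H d hd => hV H _ (f.2 H d hd)

lemma IsObservable.comp {X : CSpace.{u} n} {Y : CSpace.{v} n} (f : X.Hom Y) {V : Set Y.carrier} {k : ℕ}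
    {K : TopologicalSpace.Opens (Fin k → ℝ)} {c : Y.carrier → Fin k → ℝ}
    (hc : IsObservable Y V K c) : IsObservable X (f.1 ⁻¹' V) K (fun x => c (f x)) := by
  obtain ⟨hV, φ, hφ⟩ := hc
  exact ⟨f.isOpen_preimage hV,
    ⟨fun u => φ ⟨f u.1, u.2⟩, fun H d hd => φ.2 H (fun h => ⟨f (d h).1, (d h).2⟩) (f.2 H _ hd)⟩,
    fun u => hφ ⟨f u.1, u.2⟩⟩

lemma IsNilpotentPath.comp {X : CSpace.{u} n} {Y : CSpace.{v} n} (f : X.Hom Y) {x : ℝ → X.carrier}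
    (hx : IsNilpotentPath X x) : IsNilpotentPath Y (fun t => f (x t)) := by
  refine ⟨?_, fun V k K c hc h0 => hx.2 _ k K _ (hc.comp f) h0⟩
  have hf : @Continuous _ _ X.topology Y.topology f.1 :=
    @Continuous.mk _ _ X.topology Y.topology f.1 fun V hV => f.isOpen_preimage hV
  exact Tendsto.comp (@Continuous.tendsto _ _ X.topology Y.topology _ hf (x 0)) hx.1

/-- The extension of an arrow of `Cⁿ`: composition with nilpotent paths. -/
def Ext.map {X : CSpace.{u} n} {Y : CSpace.{v} n} (f : X.Hom Y) : Ext X → Ext Y :=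
  Quotient.map (fun x : NilpotentPath X => ⟨fun t => f (x.1 t), x.2.comp f⟩)
    fun _ _ h _ k K _ hc => h _ k K _ (hc.comp f)

lemma isNilpotentPath_const (X : CSpace.{u} n) (x : X.carrier) :
    IsNilpotentPath X (fun _ => x) := by
  refine ⟨?_, fun U k K c _ _ => ⟨1, by simp⟩⟩
  let := X.topology
  exact tendsto_const_nhds

/-- The point of the extension given by a standard point. -/
def Ext.const {X : CSpace.{u} n} (x : X.carrier) : Ext X :=
  Ext.mk ⟨fun _ => x, isNilpotentPath_const X x⟩

/-! ## Extended real spaces and the category of their subsets -/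

/-- `ℝᵐ` as a `Cⁿ` space. -/
abbrev R (n : ℕ∞) (m : ℕ) : CSpace n := Space.bar (OR.of n (⊤ : TopologicalSpace.Opens (Fin m → ℝ)))

/-- A map of class `Cⁿ` between open sets, as an arrow of `Cⁿ`. -/
def OR.hom {m k : ℕ} {W : TopologicalSpace.Opens (Fin m → ℝ)}
    {K : TopologicalSpace.Opens (Fin k → ℝ)} (f : W → K)
    (hf : ContMDiff 𝓘(ℝ, Fin m → ℝ) 𝓘(ℝ, Fin k → ℝ) n fun x => (f x : Fin k → ℝ)) :
    (Space.bar (OR.of n W)).Hom (Space.bar (OR.of n K)) :=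
  ⟨f, fun H _ hd => (OR n).isMor_comp (H := H) (J := OR.of n W) (K := OR.of n K) (g := f)
    (contMDiff_subtypeVal_comp_iff.1 hf) hd⟩

/-- The inclusion of an open set in `ℝᵐ`. -/
def inclR (n : ℕ∞) {m : ℕ} (W : TopologicalSpace.Opens (Fin m → ℝ)) :
    (Space.bar (OR.of n W)).Hom (R n m) :=
  OR.hom (fun x => ⟨x, trivial⟩) contMDiff_subtype_val

/-- The extension of an open set of `ℝᵐ`, as a subset of the extension of `ℝᵐ`. -/
def extOpen (n : ℕ∞) {m : ℕ} (W : TopologicalSpace.Opens (Fin m → ℝ)) : Set (Ext (R n m)) :=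
  range (Ext.map (inclR n W))

/-- The topology of the extension of `ℝᵐ`, generated by the extensions of open sets. -/
instance (n : ℕ∞) (m : ℕ) : TopologicalSpace (Ext (R n m)) :=
  TopologicalSpace.generateFrom (range (extOpen n))

/-- The product of open sets of `ℝᵐ` and `ℝᵏ`, in `ℝᵐ⁺ᵏ`. -/
def prodOpen {m k : ℕ} (U : TopologicalSpace.Opens (Fin m → ℝ))
    (V : TopologicalSpace.Opens (Fin k → ℝ)) : TopologicalSpace.Opens (Fin (m + k) → ℝ) :=
  ⟨{w | (fun i => w (Fin.castAdd k i)) ∈ U ∧ (fun i => w (Fin.natAdd m i)) ∈ V},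
    (U.2.preimage (by fun_prop)).inter (V.2.preimage (by fun_prop))⟩

/-- The projection `U × V → ℝᵐ`. -/
def projL (n : ℕ∞) {m k : ℕ} (U : TopologicalSpace.Opens (Fin m → ℝ))
    (V : TopologicalSpace.Opens (Fin k → ℝ)) :
    (Space.bar (OR.of n (prodOpen U V))).Hom (R n m) :=
  OR.hom (fun w => ⟨fun i => w.1 (Fin.castAdd k i), trivial⟩)
    (ContMDiff.comp (g := fun (w : Fin (m + k) → ℝ) (i : Fin m) => w (Fin.castAdd k i))
      (ContDiff.contMDiff (by fun_prop)) contMDiff_subtype_val)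

/-- The projection `U × V → ℝᵏ`. -/
def projR (n : ℕ∞) {m k : ℕ} (U : TopologicalSpace.Opens (Fin m → ℝ))
    (V : TopologicalSpace.Opens (Fin k → ℝ)) :
    (Space.bar (OR.of n (prodOpen U V))).Hom (R n k) :=
  OR.hom (fun w => ⟨fun i => w.1 (Fin.natAdd m i), trivial⟩)
    (ContMDiff.comp (g := fun (w : Fin (m + k) → ℝ) (i : Fin k) => w (Fin.natAdd m i))
      (ContDiff.contMDiff (by fun_prop)) contMDiff_subtype_val)

/-- The arrows `S → T` between subsets of extended spaces `•ℝˢ`, `•ℝᵗ`: locally they are of the form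
`x ↦ •g⟨p, x⟩` with a parameter `p ∈ •U ⊆ •ℝᵐ` and `g ∈ Cⁿ(U × V, ℝᵗ)`. Here `⟨p, x⟩` is the point
`z` of `•(U × V)` with projections `p` and `x`. -/
def IsSERMor {s t : ℕ} {S : Set (Ext (R n s))} {T : Set (Ext (R n t))} (f : S → T) : Prop :=
  ∀ x₀ : S, ∃ (m : ℕ) (p : Ext (R n m)) (U : TopologicalSpace.Opens (Fin m → ℝ))
    (V : TopologicalSpace.Opens (Fin s → ℝ))
    (g : (Space.bar (OR.of n (prodOpen U V))).Hom (R n t)),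
    p ∈ extOpen n U ∧ x₀.1 ∈ extOpen n V ∧ ∀ x : S, x.1 ∈ extOpen n V →
      ∃ z : Ext (Space.bar (OR.of n (prodOpen U V))),
        Ext.map (projL n U V) z = p ∧ Ext.map (projR n U V) z = x.1 ∧ (f x).1 = Ext.map g z

/-! ### Nilpotent paths in open sets of `ℝᵐ` -/

/-- Nilpotency at `0` of a path in a normed space. -/
def NilP {E : Type*} [NormedAddCommGroup E] (c : ℝ → E) : Prop :=
  ∃ j : ℕ, (fun t => ‖c t - c 0‖ ^ j) =o[𝓝 0] (fun t : ℝ => t)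

section NilP

variable {E G : Type*} [NormedAddCommGroup E] [NormedAddCommGroup G]

lemma NilP.continuousAt {c : ℝ → E} (h : NilP c) : ContinuousAt c 0 := by
  obtain ⟨j, hj⟩ := h
  have h0 : Tendsto (fun t => ‖c t - c 0‖ ^ j) (𝓝 0) (𝓝 0) :=
    hj.isBigO.trans_tendsto tendsto_id
  rw [ContinuousAt, tendsto_iff_norm_sub_tendsto_zero, Metric.tendsto_nhds]
  intro ε hε
  filter_upwards [(Metric.tendsto_nhds.1 h0) (ε ^ j) (by positivity)] with t ht
  rw [Real.dist_eq, sub_zero, abs_of_nonneg (by positivity)] at ht ⊢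
  exact lt_of_pow_lt_pow_left₀ j hε.le ht

lemma NilP.of_le {a : ℝ → E} {b : ℝ → G} {C : ℝ} (ha : NilP a)
    (h : ∀ᶠ t in 𝓝 0, ‖b t - b 0‖ ≤ C * ‖a t - a 0‖) : NilP b := by
  obtain ⟨j, hj⟩ := ha
  refine ⟨j, (IsBigO.of_bound (|C| ^ j) ?_).trans_isLittleO hj⟩
  filter_upwards [h] with t ht
  rw [norm_pow, norm_pow, norm_norm, norm_norm, ← mul_pow]
  gcongr
  exact ht.trans (by gcongr; exact le_abs_self C)

lemma NilP.prodMk {a : ℝ → E} {b : ℝ → G} (ha : NilP a) (hb : NilP b) :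
    NilP (fun t => (a t, b t)) := by
  have hca := ha.continuousAt
  have hcb := hb.continuousAt
  obtain ⟨j, hj⟩ := ha
  obtain ⟨k, hk⟩ := hb
  have h1 : ∀ᶠ t in 𝓝 (0 : ℝ), ‖a t - a 0‖ < 1 := by
    have := (tendsto_iff_norm_sub_tendsto_zero.1 hca)
    exact this.eventually (gt_mem_nhds one_pos)
  have h2 : ∀ᶠ t in 𝓝 (0 : ℝ), ‖b t - b 0‖ < 1 := by
    have := (tendsto_iff_norm_sub_tendsto_zero.1 hcb)
    exact this.eventually (gt_mem_nhds one_pos)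
  refine ⟨max j k, IsBigO.trans_isLittleO (IsBigO.of_bound 1 ?_) (hj.add hk)⟩
  filter_upwards [h1, h2] with t h1 h2
  rw [one_mul, norm_pow, norm_norm, Prod.mk_sub_mk, Prod.norm_mk, Real.norm_eq_abs,
    abs_of_nonneg (by positivity)]
  rcases max_choice ‖a t - a 0‖ ‖b t - b 0‖ with h | h <;> rw [h]
  · have := pow_le_pow_of_le_one (norm_nonneg (a t - a 0)) h1.le (le_max_left j k)
    have : 0 ≤ ‖b t - b 0‖ ^ k := by positivity
    linarith
  · have := pow_le_pow_of_le_one (norm_nonneg (b t - b 0)) h2.le (le_max_right j k)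
    have : 0 ≤ ‖a t - a 0‖ ^ j := by positivity
    linarith

lemma NilP.congr {a b : ℝ → E} (ha : NilP a) (h : ∀ᶠ t in 𝓝 0, a t = b t) : NilP b := by
  refine ha.of_le (C := 1) ?_
  have h0 := h.self_of_nhds
  filter_upwards [h] with t ht
  rw [ht, h0, one_mul]

lemma NilP.const (e : E) : NilP (fun _ => e) := ⟨1, by simp⟩

variable [NormedSpace ℝ E] [NormedSpace ℝ G]

lemma ContDiffAt.exists_norm_le [Fact (1 ≤ n)] {g : E → G} {x : E} (h : ContDiffAt ℝ n g x) :
    ∃ C : ℝ, ∃ s ∈ 𝓝 x, ∀ y ∈ s, ∀ z ∈ s, ‖g y - g z‖ ≤ C * ‖y - z‖ := by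
  have h1 : ContDiffAt ℝ 1 g x := h.of_le (by exact_mod_cast (Fact.out : 1 ≤ n))
  obtain ⟨C, s, hs, hC⟩ := h1.exists_lipschitzOnWith
  exact ⟨C, s, hs, fun y hy z hz => hC.norm_sub_le hy hz⟩

lemma NilP.comp [Fact (1 ≤ n)] {a : ℝ → E} (ha : NilP a) {g : E → G}
    (hg : ContDiffAt ℝ n g (a 0)) : NilP (fun t => g (a t)) := by
  obtain ⟨C, s, hs, hC⟩ := ContDiffAt.exists_norm_le hg
  refine ha.of_le (C := C) ?_
  filter_upwards [ha.continuousAt hs] with t ht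
  exact hC _ ht _ (mem_of_mem_nhds hs)

lemma isLittleO_comp [Fact (1 ≤ n)] {a b : ℝ → E} (ha : NilP a) (hb : NilP b)
    (h : (fun t => a t - b t) =o[𝓝 0] (fun t : ℝ => t)) {g : E → G}
    (hg : ContDiffAt ℝ n g (a 0)) :
    (fun t => g (a t) - g (b t)) =o[𝓝 0] (fun t : ℝ => t) := by
  have h0 : a 0 = b 0 := by
    have := (h.def one_pos).self_of_nhds
    simpa [sub_eq_zero] using this
  obtain ⟨C, s, hs, hC⟩ := ContDiffAt.exists_norm_le hg
  refine (IsBigO.of_bound C ?_).trans_isLittleO h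
  filter_upwards [ha.continuousAt hs, hb.continuousAt (h0 ▸ hs)] with t ht ht'
  exact hC _ ht _ ht'

end NilP

/-! ### The points of the extension of an open set of `ℝᵐ` -/

section OpenSets

variable {m : ℕ} {W : TopologicalSpace.Opens (Fin m → ℝ)}

lemma isObservable_val : IsObservable (Space.bar (OR.of n W)) univ
    (⊤ : TopologicalSpace.Opens (Fin m → ℝ)) (fun x : W => (x : Fin m → ℝ)) :=
  ⟨fun _ _ _ => isOpen_univ,
    (inclR n W).comp ⟨fun u => u.1, fun _ _ hd => hd⟩, fun _ => rfl⟩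

lemma isOpen_of_topology {U : Set W}
    (hU : IsOpen[(Space.bar (OR.of n W)).topology] U) : IsOpen U :=
  hU (OR.of n W) id ((OR n).isMor_id _)

lemma IsObservable.exists_contDiffAt {U : Set W} {k : ℕ} {K : TopologicalSpace.Opens (Fin k → ℝ)}
    {c : W → Fin k → ℝ} (hc : IsObservable (Space.bar (OR.of n W)) U K c) {x : W} (hx : x ∈ U) :
    ∃ G : (Fin m → ℝ) → Fin k → ℝ, (∀ y : W, c y = G y) ∧ ContDiffAt ℝ n G x := by
  obtain ⟨hU, φ, hφ⟩ := hc
  let U' : TopologicalSpace.Opens W := ⟨U, isOpen_of_topology hU⟩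
  have hmem : ∀ y : openImage W U', openImageIncl W U' y ∈ U := by
    rintro ⟨_, y, hy, rfl⟩
    exact hy
  have hfig := φ.2 (OR.of n (openImage W U')) (fun y => ⟨openImageIncl W U' y, hmem y⟩)
    ((OR n).isMor_incl (OR.of n W) U')
  have h1 : ContMDiff 𝓘(ℝ, Fin m → ℝ) 𝓘(ℝ, Fin k → ℝ) n (c ∘ openImageIncl W U') := by
    have := contMDiff_subtypeVal_comp_iff.2 hfig
    refine (congrArg (ContMDiff _ _ _) (funext fun y => ?_)).mp this
    exact (hφ ⟨openImageIncl W U' y, hmem y⟩).symm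
  have h2 : ContMDiffAt 𝓘(ℝ, Fin m → ℝ) 𝓘(ℝ, Fin k → ℝ) n c x :=
    contMDiffAt_of_comp_incl (i := openImageIncl W U') (fun _ => rfl)
      (h1 (⟨x, x, hx, rfl⟩ : openImage W U'))
  refine ⟨Function.extend Subtype.val c 0,
    fun y => (Subtype.val_injective.extend_apply c _ y).symm, ?_⟩
  rw [← contMDiffAt_iff_contDiffAt, ← contMDiffAt_subtype_iff]
  refine (congrArg (fun f => ContMDiffAt _ _ _ f x) (funext fun y => ?_)).mp h2
  exact (Subtype.val_injective.extend_apply c _ y).symm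

lemma contDiff_append {m k : ℕ} :
    ContDiff ℝ n (fun z : (Fin m → ℝ) × (Fin k → ℝ) => Fin.append z.1 z.2) := by
  rw [contDiff_pi]
  intro i
  induction i using Fin.addCases with
  | left i => simp only [Fin.append_left]; fun_prop
  | right i => simp only [Fin.append_right]; fun_prop

variable [Fact (1 ≤ n)]

lemma isNilpotentPath_iff {x : ℝ → W} :
    IsNilpotentPath (Space.bar (OR.of n W)) x ↔ NilP (fun t => (x t : Fin m → ℝ)) := by
  constructor
  · intro h
    exact h.2 univ m ⊤ _ isObservable_val trivial
  · intro h
    refine ⟨?_, fun U k K c hc h0 => ?_⟩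
    · have h1 : Tendsto x (𝓝 0) (𝓝 (x 0)) := tendsto_subtype_rng.2 h.continuousAt
      exact h1.mono_right (nhds_mono (fun U hU => isOpen_of_topology hU))
    · obtain ⟨G, hG, hd⟩ := hc.exists_contDiffAt h0
      have := NilP.comp (g := G) h hd
      simp only [← hG] at this
      exact this

/-- The point of `•W` given by a nilpotent path in `ℝᵐ` with values in `W`. -/
def mkW (n : ℕ∞) [Fact (1 ≤ n)] (W : TopologicalSpace.Opens (Fin m → ℝ)) (c : ℝ → Fin m → ℝ)
    (hc : NilP c) (h : ∀ t, c t ∈ W) : Ext (Space.bar (OR.of n W)) :=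
  Ext.mk ⟨fun t => ⟨c t, h t⟩, isNilpotentPath_iff.2 hc⟩

/-- The point of `•ℝᵐ` given by a nilpotent path in `ℝᵐ`. -/
def mkR (n : ℕ∞) [Fact (1 ≤ n)] (c : ℝ → Fin m → ℝ) (hc : NilP c) : Ext (R n m) :=
  mkW n ⊤ c hc fun _ => trivial

lemma exists_mkW (z : Ext (Space.bar (OR.of n W))) : ∃ c hc h, z = mkW n W c hc h := by
  induction z using Quotient.inductionOn with
  | h x => exact ⟨fun t => (show W from x.1 t).1, isNilpotentPath_iff.1 x.2, fun t => (show W from x.1 t).2, rfl⟩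

lemma exists_mkR (z : Ext (R n m)) : ∃ c hc, z = mkR n c hc := by
  obtain ⟨c, hc, _, h⟩ := exists_mkW z
  exact ⟨c, hc, h⟩

lemma mkW_eq_iff {c c' : ℝ → Fin m → ℝ} {hc hc'} {h : ∀ t, c t ∈ W} {h' : ∀ t, c' t ∈ W} :
    mkW n W c hc h = mkW n W c' hc' h' ↔ (fun t => c t - c' t) =o[𝓝 0] (fun t : ℝ => t) := by
  constructor
  · intro e
    exact ((Quotient.exact e) univ m ⊤ _ isObservable_val).2 trivial
  · intro e
    refine Quotient.sound fun U k K d hd => ?_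
    have h0 : c 0 = c' 0 := by
      have := (e.def one_pos).self_of_nhds
      simpa [sub_eq_zero] using this
    have h0' : (⟨c 0, h 0⟩ : W) = ⟨c' 0, h' 0⟩ := Subtype.ext h0
    refine ⟨Eq.to_iff (congrArg (· ∈ U) h0'), fun hx => ?_⟩
    obtain ⟨G, hG, hdG⟩ := hd.exists_contDiffAt hx
    have := isLittleO_comp (g := G) hc hc' e hdG
    refine (congrArg (fun f => f =o[𝓝 0] fun t : ℝ => t) (funext fun t => ?_)).mp this
    exact congrArg₂ (· - ·) (hG ⟨c t, h t⟩).symm (hG ⟨c' t, h' t⟩).symm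

lemma mkR_eq_iff {c c' : ℝ → Fin m → ℝ} {hc hc'} :
    mkR n c hc = mkR n c' hc' ↔ (fun t => c t - c' t) =o[𝓝 0] (fun t : ℝ => t) :=
  mkW_eq_iff

lemma mkR_congr {c c' : ℝ → Fin m → ℝ} {hc hc'} (h : ∀ᶠ t in 𝓝 0, c t = c' t) :
    mkR n c hc = mkR n c' hc' := by
  rw [mkR_eq_iff]
  refine (IsBigO.of_bound 0 ?_).trans_isLittleO (isLittleO_zero _ _ : (fun _ => (0 : ℝ)) =o[_] _)
  filter_upwards [h] with t ht
  simp [ht]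

lemma map_mkW {k : ℕ} {K : TopologicalSpace.Opens (Fin k → ℝ)}
    (g : (Space.bar (OR.of n W)).Hom (Space.bar (OR.of n K))) {c : ℝ → Fin m → ℝ} {hc}
    {h : ∀ t, c t ∈ W} : ∃ hg : NilP (fun t => (show K from g ⟨c t, h t⟩).1),
      Ext.map g (mkW n W c hc h) = mkW n K _ hg fun t => (show K from g ⟨c t, h t⟩).2 :=
  ⟨isNilpotentPath_iff.1 ((isNilpotentPath_iff (n := n) (x := fun t => ⟨c t, h t⟩)).2 hc |>.comp g),
    rfl⟩

lemma mkR_mem_extOpen {c : ℝ → Fin m → ℝ} {hc} : mkR n c hc ∈ extOpen n W ↔ c 0 ∈ W := by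
  constructor
  · rintro ⟨z, hz⟩
    obtain ⟨a, ha, haW, rfl⟩ := exists_mkW z
    have e : (fun t => a t - c t) =o[𝓝 0] (fun t : ℝ => t) := (mkR_eq_iff (hc := ha)).1 hz
    have := (e.def one_pos).self_of_nhds
    have h0 : a 0 = c 0 := by simpa [sub_eq_zero] using this
    exact h0 ▸ haW 0
  · intro h0
    classical
    have hev : ∀ᶠ t in 𝓝 0, c t = if c t ∈ W then c t else c 0 := by
      filter_upwards [hc.continuousAt (W.2.mem_nhds h0)] with t ht
      exact (if_pos (show c t ∈ W from ht)).symm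
    refine ⟨mkW n W (fun t => if c t ∈ W then c t else c 0) (hc.congr hev) fun t => ?_, ?_⟩
    · split_ifs with h
      exacts [h, h0]
    · exact (mkR_congr (hc := hc) (hc' := hc.congr hev) hev).symm

lemma isOpen_ext_iff {𝒰 : Set (Ext (R n m))} :
    IsOpen 𝒰 ↔ ∃ V : TopologicalSpace.Opens (Fin m → ℝ), 𝒰 = extOpen n V := by
  constructor
  · intro h
    induction h with
    | basic _ h => obtain ⟨V, rfl⟩ := h; exact ⟨V, rfl⟩
    | univ =>
      refine ⟨⊤, (eq_univ_of_forall fun z => ?_).symm⟩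
      obtain ⟨c, hc, rfl⟩ := exists_mkR z
      exact mkR_mem_extOpen.2 trivial
    | inter _ _ _ _ h₁ h₂ =>
      obtain ⟨V₁, rfl⟩ := h₁
      obtain ⟨V₂, rfl⟩ := h₂
      refine ⟨V₁ ⊓ V₂, Set.ext fun z => ?_⟩
      obtain ⟨c, hc, rfl⟩ := exists_mkR z
      simp only [mem_inter_iff, mkR_mem_extOpen]
      rfl
    | sUnion S _ h =>
      choose! V hV using h
      refine ⟨⨆ s ∈ S, V s, Set.ext fun z => ?_⟩
      obtain ⟨c, hc, rfl⟩ := exists_mkR z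
      rw [mkR_mem_extOpen]
      simp only [TopologicalSpace.Opens.mem_iSup, mem_sUnion, exists_prop]
      refine exists_congr fun s => and_congr_right fun hs => ?_
      rw [hV s hs, mkR_mem_extOpen, ← hV s hs]
  · rintro ⟨V, rfl⟩
    exact TopologicalSpace.isOpen_generateFrom_of_mem ⟨V, rfl⟩

lemma isOpen_subtype_iff {S : Set (Ext (R n m))} {𝒰 : Set S} :
    IsOpen 𝒰 ↔ ∃ V : TopologicalSpace.Opens (Fin m → ℝ), 𝒰 = {x | x.1 ∈ extOpen n V} := by
  rw [isOpen_induced_iff]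
  constructor
  · rintro ⟨O, hO, rfl⟩
    obtain ⟨V, rfl⟩ := isOpen_ext_iff.1 hO
    exact ⟨V, rfl⟩
  · rintro ⟨V, rfl⟩
    exact ⟨_, isOpen_ext_iff.2 ⟨V, rfl⟩, rfl⟩

/-- The arrows of `IsSERMor`, in terms of paths. -/
def IsPathMor {s t : ℕ} {S : Set (Ext (R n s))} {T : Set (Ext (R n t))} (f : S → T) : Prop :=
  ∀ (b₀ : ℝ → Fin s → ℝ) (hb₀ : NilP b₀), mkR n b₀ hb₀ ∈ S →
    ∃ (P : Type) (_ : NormedAddCommGroup P) (_ : NormedSpace ℝ P) (_ : FiniteDimensional ℝ P)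
      (a : ℝ → P) (O : Set (P × (Fin s → ℝ))) (G : P × (Fin s → ℝ) → Fin t → ℝ),
      NilP a ∧ IsOpen O ∧ ContDiffOn ℝ n G O ∧ (a 0, b₀ 0) ∈ O ∧
      ∀ (b : ℝ → Fin s → ℝ) (hb : NilP b) (hS : mkR n b hb ∈ S), (a 0, b 0) ∈ O →
        ∃ hc : NilP (fun t => G (a t, b t)), (f ⟨mkR n b hb, hS⟩).1 = mkR n _ hc

lemma NilP.append (n : ℕ∞) [Fact (1 ≤ n)] {m k : ℕ} {a : ℝ → Fin m → ℝ} {b : ℝ → Fin k → ℝ} (ha : NilP a) (hb : NilP b) :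
    NilP (fun t => Fin.append (a t) (b t)) :=
  NilP.comp (n := n) (g := fun z : (Fin m → ℝ) × (Fin k → ℝ) => Fin.append z.1 z.2)
    (ha.prodMk hb) (contDiff_append.contDiffAt)

lemma IsSERMor.isPathMor {s t : ℕ} {S : Set (Ext (R n s))} {T : Set (Ext (R n t))} {f : S → T}
    (h : IsSERMor f) : IsPathMor f := by
  intro b₀ hb₀ hS₀
  obtain ⟨m, p, U, V, g, hp, hV, hg⟩ := h ⟨_, hS₀⟩
  obtain ⟨a, ha, rfl⟩ := exists_mkR p
  rw [mkR_mem_extOpen] at hp hV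
  let g' : prodOpen U V → Fin t → ℝ := fun w =>
    (show (⊤ : TopologicalSpace.Opens (Fin t → ℝ)) from g w).1
  have hg' : ContMDiff 𝓘(ℝ, Fin (m + s) → ℝ) 𝓘(ℝ, Fin t → ℝ) n g' :=
    contMDiff_subtypeVal_comp_iff.2 (g.2 (OR.of n (prodOpen U V)) id ((OR n).isMor_id _))
  let G' : (Fin (m + s) → ℝ) → Fin t → ℝ := Function.extend Subtype.val g' 0
  have hG' : ∀ w : prodOpen U V, G' w = g' w := fun w => Subtype.val_injective.extend_apply g' _ w
  have hG'd : ∀ w (hw : w ∈ prodOpen U V), ContDiffAt ℝ n G' w := fun w hw => by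
    rw [← contMDiffAt_iff_contDiffAt,
      ← contMDiffAt_subtype_iff (f := G') (x := (⟨w, hw⟩ : prodOpen U V))]
    exact (congrArg (fun f => ContMDiffAt _ _ _ f _) (funext hG')).mpr (hg' ⟨w, hw⟩)
  let A : (Fin m → ℝ) × (Fin s → ℝ) → Fin (m + s) → ℝ := fun z => Fin.append z.1 z.2
  have hA : ∀ u ∈ U, ∀ v ∈ V, A (u, v) ∈ prodOpen U V := fun u hu v hv => by
    constructor
    · exact (congrArg (· ∈ U) (funext fun i => Fin.append_left u v i)).mpr hu
    · exact (congrArg (· ∈ V) (funext fun i => Fin.append_right u v i)).mpr hv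
  have hGd : ∀ u ∈ U, ∀ v ∈ V, ContDiffAt ℝ n (fun z => G' (A z)) (u, v) := fun u hu v hv =>
    ContDiffAt.comp (u, v) (hG'd (A (u, v)) (hA u hu v hv)) contDiff_append.contDiffAt
  refine ⟨Fin m → ℝ, inferInstance, inferInstance, inferInstance, a, U ×ˢ V, fun z => G' (A z),
    ha, U.2.prod V.2, fun z hz => (hGd z.1 hz.1 z.2 hz.2).contDiffWithinAt, ⟨hp, hV⟩, ?_⟩
  intro b hb hS h0
  obtain ⟨z, hz1, hz2, hz3⟩ := hg ⟨_, hS⟩ ((mkR_mem_extOpen (hc := hb)).2 h0.2)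
  obtain ⟨w, hw, hwm, rfl⟩ := exists_mkW z
  have hab : NilP (fun t => (a t, b t)) := ha.prodMk hb
  refine ⟨NilP.comp (g := fun z => G' (A z)) hab (hGd _ h0.1 _ h0.2), ?_⟩
  rw [hz3]
  obtain ⟨hgw, e⟩ := map_mkW g (hc := hw) (h := hwm)
  rw [e]
  obtain ⟨h1, e1⟩ := map_mkW (projL n U V) (hc := hw) (h := hwm)
  obtain ⟨h2, e2⟩ := map_mkW (projR n U V) (hc := hw) (h := hwm)
  have l1 : (fun t => (fun i => w t (Fin.castAdd s i)) - a t) =o[𝓝 0] (fun t : ℝ => t) :=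
    (mkR_eq_iff (hc := h1) (hc' := ha)).1 (e1.symm.trans hz1)
  have l2 : (fun t => (fun i => w t (Fin.natAdd m i)) - b t) =o[𝓝 0] (fun t : ℝ => t) :=
    (mkR_eq_iff (hc := h2) (hc' := hb)).1 (e2.symm.trans hz2)
  have l : (fun t => ((fun i => w t (Fin.castAdd s i) : Fin m → ℝ),
      (fun i => w t (Fin.natAdd m i) : Fin s → ℝ)) - (a t, b t)) =o[𝓝 0] (fun t : ℝ => t) :=
    l1.prod_left l2
  have := isLittleO_comp (g := fun z => G' (A z)) (h1.prodMk h2) hab l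
    (hGd _ (hwm 0).1 _ (hwm 0).2)
  refine (mkR_eq_iff (hc := hgw)).2 ((congrArg (fun f => f =o[𝓝 0] fun t : ℝ => t)
    (funext fun t => ?_)).mp this)
  congr 1
  have : A ((fun i => w t (Fin.castAdd s i) : Fin m → ℝ),
      (fun i => w t (Fin.natAdd m i) : Fin s → ℝ)) = w t := Fin.append_castAdd_natAdd
  exact (congrArg G' this).trans (hG' ⟨w t, hwm t⟩)

lemma IsPathMor.isSERMor {s t : ℕ} {S : Set (Ext (R n s))} {T : Set (Ext (R n t))} {f : S → T}
    (h : IsPathMor f) : IsSERMor f := by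
  classical
  rintro ⟨x₀, hx₀⟩
  obtain ⟨b₀, hb₀, rfl⟩ := exists_mkR x₀
  obtain ⟨P, _, _, _, a, O, G, ha, hO, hG, h0, hf⟩ := h b₀ hb₀ hx₀
  let e : P ≃L[ℝ] (Fin (Module.finrank ℝ P) → ℝ) := (Module.finBasis ℝ P).equivFunL
  obtain ⟨U', V, hU', haU', hV, hbV, hUV⟩ := mem_nhds_prod_iff'.1 (hO.mem_nhds h0)
  let U : TopologicalSpace.Opens (Fin (Module.finrank ℝ P) → ℝ) :=
    ⟨e.symm ⁻¹' U', hU'.preimage e.symm.continuous⟩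
  let V : TopologicalSpace.Opens (Fin s → ℝ) := ⟨V, hV⟩
  let B : (Fin (Module.finrank ℝ P + s) → ℝ) → P × (Fin s → ℝ) := fun w =>
    (e.symm fun i => w (Fin.castAdd s i), fun i => w (Fin.natAdd _ i))
  have hB : ContDiff ℝ n B := by
    refine ContDiff.prodMk (e.symm.contDiff.comp ?_) ?_ <;> fun_prop
  have hBO : ∀ w ∈ prodOpen U V, B w ∈ O := fun w hw => hUV ⟨hw.1, hw.2⟩
  have hgd : ContMDiff 𝓘(ℝ, Fin (Module.finrank ℝ P + s) → ℝ) 𝓘(ℝ, Fin t → ℝ) n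
      (fun w : prodOpen U V => G (B w)) := fun w => by
    rw [contMDiffAt_subtype_iff (f := fun w => G (B w)), contMDiffAt_iff_contDiffAt]
    exact ContDiffAt.comp _ (hG.contDiffAt (hO.mem_nhds (hBO w w.2))) hB.contDiffAt
  have hea : NilP (fun t => e (a t)) := ha.comp (n := n) (g := e) e.contDiff.contDiffAt
  refine ⟨_, mkR n _ hea, U, V, OR.hom (fun w => ⟨G (B w), trivial⟩) hgd,
    mkR_mem_extOpen.2 (by simpa [U] using haU'), (mkR_mem_extOpen (hc := hb₀)).2 hbV, ?_⟩
  rintro ⟨x, hx⟩ hxV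
  obtain ⟨b, hb, rfl⟩ := exists_mkR x
  have hxV : b 0 ∈ V := (mkR_mem_extOpen (hc := hb)).1 hxV
  let c : ℝ → Fin (Module.finrank ℝ P + s) → ℝ := fun t => Fin.append (e (a t)) (b t)
  have hc : NilP c := hea.append n hb
  have hc0 : c 0 ∈ prodOpen U V := by
    simpa [c, prodOpen, U] using ⟨haU', hxV⟩
  have hBc : ∀ t, B (c t) = (a t, b t) := fun t => by simp [B, c]
  have hev : ∀ᶠ t in 𝓝 0, c t = if c t ∈ prodOpen U V then c t else c 0 := by
    filter_upwards [hc.continuousAt ((prodOpen U V).2.mem_nhds hc0)] with t ht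
    exact (if_pos (show c t ∈ prodOpen U V from ht)).symm
  have hmem : ∀ t, (if c t ∈ prodOpen U V then c t else c 0) ∈ prodOpen U V := fun t => by
    split_ifs with h
    exacts [h, hc0]
  refine ⟨mkW n (prodOpen U V) _ (hc.congr hev) hmem, ?_, ?_, ?_⟩
  · obtain ⟨h1, e1⟩ := map_mkW (projL n U V) (hc := hc.congr hev) (h := hmem)
    rw [e1]
    refine mkR_congr (hc := h1) ?_
    filter_upwards [hev] with t ht
    refine (congrArg (fun w : Fin (Module.finrank ℝ P + s) → ℝ =>
      fun i => w (Fin.castAdd s i)) ht.symm).trans ?_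
    simp [c]
  · obtain ⟨h1, e1⟩ := map_mkW (projR n U V) (hc := hc.congr hev) (h := hmem)
    rw [e1]
    refine mkR_congr (hc := h1) (hc' := hb) ?_
    filter_upwards [hev] with t ht
    refine (congrArg (fun w : Fin (Module.finrank ℝ P + s) → ℝ =>
      fun i => w (Fin.natAdd _ i)) ht.symm).trans ?_
    simp [c]
  · obtain ⟨h1, e1⟩ := map_mkW (OR.hom (n := n) (K := ⊤)
      (fun w : prodOpen U V => ⟨G (B w), trivial⟩) hgd) (hc := hc.congr hev) (h := hmem)
    obtain ⟨h2, e2⟩ := hf b hb hx (hUV ⟨haU', hxV⟩)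
    rw [e1, e2]
    refine mkR_congr (hc := h2) ?_
    filter_upwards [hev] with t ht
    exact (congrArg G (hBc t)).symm.trans (congrArg (fun w => G (B w)) ht)

lemma isSERMor_iff {s t : ℕ} {S : Set (Ext (R n s))} {T : Set (Ext (R n t))} {f : S → T} :
    IsSERMor f ↔ IsPathMor f := ⟨fun h => h.isPathMor, fun h => h.isSERMor⟩

/-! ### The laws of the category of subsets of extended real spaces -/

lemma isSERMor_id {s : ℕ} (S : Set (Ext (R n s))) : IsSERMor (id : S → S) := by
  refine IsPathMor.isSERMor fun b₀ _ _ => ⟨ℝ, inferInstance, inferInstance, inferInstance,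
    fun _ => 0, univ, Prod.snd, NilP.const 0, isOpen_univ, contDiffOn_snd, trivial,
    fun b hb _ _ => ⟨hb, rfl⟩⟩

lemma IsSERMor.comp {s t r : ℕ} {S : Set (Ext (R n s))} {T : Set (Ext (R n t))}
    {Q : Set (Ext (R n r))} {g : T → Q} {f : S → T} (hg : IsSERMor g) (hf : IsSERMor f) :
    IsSERMor (g ∘ f) := by
  refine IsPathMor.isSERMor fun b₀ hb₀ hS₀ => ?_
  obtain ⟨P, _, _, _, a, O, G, ha, hO, hG, h0, hfG⟩ := hf.isPathMor b₀ hb₀ hS₀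
  obtain ⟨hc₀, e₀⟩ := hfG b₀ hb₀ hS₀ h0
  obtain ⟨P', _, _, _, a', O', G', ha', hO', hG', h0', hgG⟩ :=
    hg.isPathMor _ hc₀ (e₀ ▸ (f ⟨_, hS₀⟩).2)
  let π : (P' × P) × (Fin s → ℝ) → P × (Fin s → ℝ) := fun z => (z.1.2, z.2)
  let k : (P' × P) × (Fin s → ℝ) → P' × (Fin t → ℝ) := fun z => (z.1.1, G (π z))
  have hπ : ContDiff ℝ n π := by fun_prop
  have hk : ContDiffOn ℝ n k (π ⁻¹' O) :=
    ContDiffOn.prodMk (by fun_prop) (hG.comp hπ.contDiffOn fun _ h => h)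
  have hπO : IsOpen (π ⁻¹' O) := hO.preimage hπ.continuous
  refine ⟨P' × P, inferInstance, inferInstance, inferInstance, fun t => (a' t, a t),
    π ⁻¹' O ∩ k ⁻¹' O', fun z => G' (k z), ha'.prodMk ha,
    hk.continuousOn.isOpen_inter_preimage hπO hO',
    hG'.comp (hk.mono inter_subset_left) fun _ h => h.2, ⟨h0, h0'⟩, ?_⟩
  intro b hb hS hmem
  obtain ⟨hc, e⟩ := hfG b hb hS hmem.1
  have hT : mkR n (fun t => G (a t, b t)) hc ∈ T := e ▸ (f ⟨_, hS⟩).2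
  obtain ⟨hd, e'⟩ := hgG _ hc hT hmem.2
  refine ⟨hd, ?_⟩
  rw [← e']
  exact congrArg (fun x => (g x).1) (Subtype.ext e)

lemma isSERMor_const {s t : ℕ} (S : Set (Ext (R n s))) {T : Set (Ext (R n t))} (y : T) :
    IsSERMor (fun _ : S => y) := by
  obtain ⟨y, hy⟩ := y
  obtain ⟨a, ha, rfl⟩ := exists_mkR y
  exact IsPathMor.isSERMor fun b₀ _ _ => ⟨Fin t → ℝ, inferInstance, inferInstance, inferInstance,
    a, univ, Prod.fst, ha, isOpen_univ, contDiffOn_fst, trivial, fun b hb _ _ => ⟨ha, rfl⟩⟩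

lemma IsSERMor.continuous {s t : ℕ} {S : Set (Ext (R n s))} {T : Set (Ext (R n t))} {f : S → T}
    (hf : IsSERMor f) : Continuous f := by
  refine ⟨fun 𝒰 h𝒰 => ?_⟩
  obtain ⟨V', rfl⟩ := isOpen_subtype_iff.1 h𝒰
  rw [isOpen_iff_forall_mem_open]
  rintro ⟨x, hx⟩ hxV
  obtain ⟨b₀, hb₀, rfl⟩ := exists_mkR x
  obtain ⟨P, _, _, _, a, O, G, ha, hO, hG, h0, hfG⟩ := hf.isPathMor b₀ hb₀ hx
  let ι : (Fin s → ℝ) → P × (Fin s → ℝ) := fun v => (a 0, v)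
  have hι : Continuous ι := by fun_prop
  let V : TopologicalSpace.Opens (Fin s → ℝ) := ⟨ι ⁻¹' (O ∩ G ⁻¹' V'),
    (hG.continuousOn.isOpen_inter_preimage hO V'.2).preimage hι⟩
  have key : ∀ (b : ℝ → Fin s → ℝ) (hb : NilP b) (hS : mkR n b hb ∈ S), (a 0, b 0) ∈ O →
      ((f ⟨mkR n b hb, hS⟩).1 ∈ extOpen n V' ↔ G (a 0, b 0) ∈ V') := by
    intro b hb hS h
    obtain ⟨hc, e⟩ := hfG b hb hS h
    rw [e]
    exact mkR_mem_extOpen (hc := hc)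
  refine ⟨{x | x.1 ∈ extOpen n V}, ?_, isOpen_subtype_iff.2 ⟨V, rfl⟩, ?_⟩
  · rintro ⟨x, hx⟩ hxV
    obtain ⟨b, hb, rfl⟩ := exists_mkR x
    have hbV : b 0 ∈ V := (mkR_mem_extOpen (hc := hb)).1 hxV
    exact (key b hb hx hbV.1).2 hbV.2
  · exact (mkR_mem_extOpen (hc := hb₀)).2 ⟨h0, (key b₀ hb₀ hx h0).1 hxV⟩

lemma isSERMor_of_val {s : ℕ} {S T : Set (Ext (R n s))} {f : S → T} (hf : ∀ x, (f x).1 = x.1) :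
    IsSERMor f := by
  refine IsPathMor.isSERMor fun b₀ _ _ => ⟨ℝ, inferInstance, inferInstance, inferInstance,
    fun _ => 0, univ, Prod.snd, NilP.const 0, isOpen_univ, contDiffOn_snd, trivial,
    fun b hb _ _ => ⟨hb, hf _⟩⟩

lemma isSERMor_sheaf {s t : ℕ} {S : Set (Ext (R n s))} {T : Set (Ext (R n t))} {f : S → T}
    (h : ∀ x : S, ∃ (U : Set S) (S' : Set (Ext (R n s))) (i : S' → S), IsOpen U ∧ x ∈ U ∧
      (∀ y, (i y).1 = y.1) ∧ (∀ y ∈ U, y.1 ∈ S') ∧ IsSERMor (f ∘ i)) : IsSERMor f := by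
  refine IsPathMor.isSERMor fun b₀ hb₀ hS₀ => ?_
  obtain ⟨U, S', i, hU, hxU, hi, hUS, hf⟩ := h ⟨_, hS₀⟩
  obtain ⟨V, rfl⟩ := isOpen_subtype_iff.1 hU
  have hbV : b₀ 0 ∈ V := (mkR_mem_extOpen (hc := hb₀)).1 hxU
  obtain ⟨P, _, _, _, a, O, G, ha, hO, hG, h0, hfG⟩ := hf.isPathMor b₀ hb₀ (hUS _ hxU)
  refine ⟨P, inferInstance, inferInstance, inferInstance, a, O ∩ univ ×ˢ V, G, ha,
    hO.inter (isOpen_univ.prod V.2), hG.mono inter_subset_left, ⟨h0, trivial, hbV⟩, ?_⟩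
  intro b hb hS hmem
  have hbU : mkR n b hb ∈ extOpen n V := (mkR_mem_extOpen (hc := hb)).2 hmem.2.2
  obtain ⟨hc, e⟩ := hfG b hb (hUS ⟨_, hS⟩ hbU) hmem.1
  refine ⟨hc, ?_⟩
  rw [← e]
  exact congrArg (fun x => (f x).1) (Subtype.ext (hi ⟨_, hUS ⟨_, hS⟩ hbU⟩).symm)

end OpenSets

/-- The subsets of the extended spaces `•ℝˢ`, `s ∈ ℕ`. -/
abbrev SERObj (n : ℕ∞) := Σ s : ℕ, Set (Ext (R n s))

/-- The category of subsets of the extended spaces `•ℝˢ`. -/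
def SER (n : ℕ∞) [Fact (1 ≤ n)] : FigCat where
  Obj := SERObj n
  carrier H := H.2
  top _ := inferInstance
  IsMor f := IsSERMor f
  restr H U := ⟨H.1, Subtype.val '' (U : Set H.2)⟩
  incl H U := fun x => ⟨x.1, Subtype.coe_image_subset _ _ x.2⟩
  incl_isOpenEmbedding H U := by
    refine ⟨.of_comp (by fun_prop) continuous_subtype_val .subtypeVal, ?_⟩
    convert U.2 using 1
    ext x
    constructor
    · rintro ⟨⟨_, y, hy, rfl⟩, rfl⟩
      exact hy
    · intro hx
      exact ⟨⟨x, x, hx, rfl⟩, rfl⟩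
  range_incl H U := by
    ext x
    constructor
    · rintro ⟨⟨_, y, hy, rfl⟩, rfl⟩
      exact hy
    · intro hx
      exact ⟨⟨x, x, hx, rfl⟩, rfl⟩
  continuous_of_isMor h := h.continuous
  isMor_id H := isSERMor_id H.2
  isMor_comp hg hf := hg.comp hf
  isMor_const y := isSERMor_const _ y
  isMor_incl _ _ := isSERMor_of_val fun _ => rfl
  isMor_lift {H K V f} h := fun x₀ => h x₀
  isMor_sheaf {H K f} h := isSERMor_sheaf fun x => by
    obtain ⟨U, hx, hU⟩ := h x
    exact ⟨U, Subtype.val '' (U : Set H.2),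
      fun x => ⟨x.1, Subtype.coe_image_subset _ _ x.2⟩, U.2, hx, fun _ => rfl,
      fun y hy => ⟨y, hy, rfl⟩, hU⟩

/-! ## Extended spaces -/

/-- The category of extended `Cⁿ` spaces. -/
abbrev ECSpace (n : ℕ∞) [Fact (1 ≤ n)] := Space.{u} (SER n)

variable [Fact (1 ≤ n)]

/-- The extended space `•(ZX)` induced on `Z ⊆ •X` by the `Cⁿ` space `X`: it is generated by the
constant maps and by the maps `•h|_T : T → Z`, where `h : V̄ → X` is a figure of `X` and
`T ⊆ •V ⊆ •ℝᵗ`. -/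
def extInduced (X : CSpace.{u} n) (Z : Set (Ext X)) : ECSpace.{u} n :=
  Space.gen (F := SER n) Z
    (fun (T : SERObj n) => {d : T.2 → Z | (∃ z, ∀ x, d x = z) ∨
      ∃ (V : TopologicalSpace.Opens (Fin T.1 → ℝ)) (h : (Space.bar (OR.of n V)).Hom X),
        ∀ x : T.2, ∃ y : Ext (Space.bar (OR.of n V)),
          Ext.map (inclR n V) y = x.1 ∧ (d x).1 = Ext.map h y})
    (fun _ x => Or.inl ⟨x, fun _ => rfl⟩)

/-- The extension `•X` of a `Cⁿ` space as an extended space. -/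
def extSpace (X : CSpace.{u} n) : ECSpace.{u} n := extInduced X univ

/-- A point of `•X`, as a point of the extended space. -/
def Ext.toSpace {X : CSpace.{u} n} (z : Ext X) : (extSpace X).carrier :=
  (⟨z, trivial⟩ : (univ : Set (Ext X)))

/-- The set of first order infinitesimals: the points `h` of `•ℝ` with `h(t) = O(t)`. -/
def firstOrder (n : ℕ∞) : Set (Ext (R n 1)) :=
  {h | ∃ c : NilpotentPath (R n 1), h = Ext.mk c ∧
    (fun t => (show (⊤ : TopologicalSpace.Opens (Fin 1 → ℝ)) from c.1 t).1) =O[𝓝 0]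
      (fun t : ℝ => t)}

/-- The extended space `D` of first order infinitesimals. -/
def D (n : ℕ∞) [Fact (1 ≤ n)] : ECSpace n := extInduced (R n 1) (firstOrder n)

/-- The point `0` of `D`. -/
def D.zero (n : ℕ∞) [Fact (1 ≤ n)] : (D n).carrier :=
  show firstOrder n from
    ⟨Ext.const (X := R n 1) (⟨0, trivial⟩ : (⊤ : TopologicalSpace.Opens (Fin 1 → ℝ))), _, rfl,
      isBigO_zero _ _⟩

/-- An extended space `X` is infinitesimally linear if for every `k > 1` any `k` tangent vectors
`tᵢ : D → X` at a common point `x` determine a unique arrow `p : Dᵏ → X` with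
`p(0, …, 0, h, 0, …, 0) = tᵢ(h)` for all `i` and all `h ∈ D` (with `h` in the `i`-th place). -/
def InfLinear (X : ECSpace.{u} n) : Prop :=
  ∀ k : ℕ, 1 < k → ∀ (x : X.carrier) (t : Fin k → (D n).Hom X), (∀ i, t i (D.zero n) = x) →
    ∃! p : ((D n).pow k).Hom X, ∀ (i : Fin k) (h : (D n).carrier),
      p (Function.update (fun _ => D.zero n) i h) = t i h

/-- The extension of a manifold. -/
def Man.ext (M : Man.{u} n) : ECSpace.{u} n := extSpace M.toCSpace

/-- The iterated exponential `(…((X^{•M₁})^{•M₂})…)^{•Mₛ}`. -/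
def iterExp : ECSpace.{u} n → List (Man.{u} n) → ECSpace.{u} n
  | X, [] => X
  | X, M :: L => iterExp (M.ext.exp X) L

/-- The evaluation `F ↦ F(mₛ)…(m₁)` of an element `F` of `(…((X^{•M₁})^{•M₂})…)^{•Mₛ}` at the point
`z` of `•(M₁ × … × Mₛ)` with projections `mᵢ ∈ •Mᵢ`. -/
noncomputable def evalIter : (X : ECSpace.{u} n) → (M : Man.{u} n) → (L : List (Man.{u} n)) →
    (iterExp X (M :: L)).carrier → Ext (M.listProd L).toCSpace → X.carrier
  | _, _, [], F, z => F.1 z.toSpace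
  | X, M, N :: L, F, z =>
    (evalIter (M.ext.exp X) N L F (Ext.map (M.snd (N.listProd L)) z)).1
      (Ext.map (M.fst (N.listProd L)) z).toSpace

end IDG

/-!
By Taylor's formula, `•g(a + h) = •g(a) + •(g'(a)) h` for first order infinitesimals `h`, so an
arrow `Dᵏ → •ℝᵐ` is affine, and it is the sum of its restrictions to the axes, corrected at the
base point. An arrow `Dᵏ → •X` stays in the domain of any chart around its value at `0`, so in
coordinates the same holds for every `X` that is covered by charts; this proves that `•X` is
infinitesimally linear. For an exponential `(•X)^A` the arrow `Dᵏ → •X` is constructed separately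
for each `a ∈ A`, and the affine formula shows that it depends on `a` as an arrow. Finally, products
of charts are charts, so the extension preserves products, and the isomorphism is iterated currying.
-/

namespace IDG

/-! ## Exponentials in the cartesian closure -/

namespace Space

variable {F : FigCat} {X : Space.{u} F} {Y : Space.{v} F} {Z : Space F}

@[ext]
lemma Hom.ext {f g : X.Hom Y} (h : ∀ x, f x = g x) : f = g :=
  Subtype.ext (funext h)

/-- The identity arrow. -/
def Hom.id (X : Space.{u} F) : X.Hom X :=
  ⟨fun x => x, fun _ _ hd => hd⟩

/-- The identity isomorphism. -/
def Iso.refl (X : Space.{u} F) : X.Iso X :=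
  ⟨Hom.id X, Hom.id X, fun _ => rfl, fun _ => rfl⟩

/-- Composition of isomorphisms. -/
def Iso.trans (φ : X.Iso Y) (ψ : Y.Iso Z) : X.Iso Z where
  hom := ψ.hom.comp φ.hom
  inv := φ.inv.comp ψ.inv
  hom_inv z := (congrArg ψ.hom.1 (φ.hom_inv _)).trans (ψ.hom_inv z)
  inv_hom x := (congrArg φ.inv.1 (ψ.inv_hom _)).trans (φ.inv_hom x)

/-- Evaluation at a point, as an arrow of the cartesian closure. -/
def evalHom (Z : Space F) (y : Y.carrier) : (Y.exp Z).Hom Z :=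
  ⟨fun f => f.1 y, fun H _ hd => hd H (fun h => (h, y)) ⟨F.isMor_id H, Y.fig_const H y⟩⟩

/-- The transpose `X → Z^Y` of an arrow `X × Y → Z`. -/
def curry (f : (X.prod Y).Hom Z) : X.Hom (Y.exp Z) :=
  ⟨fun x => ⟨fun y => f (x, y), fun H d hd => f.2 H (fun h => (x, d h)) ⟨X.fig_const H x, hd⟩⟩,
    fun _ d hd K e he => f.2 K (fun k => (d (e k).1, (e k).2)) ⟨X.fig_comp he.1 hd, he.2⟩⟩

lemma fig_eval {H : F.Obj} {d : F.carrier H → (Y.exp Z).carrier} (hd : (Y.exp Z).fig H d)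
    {e : F.carrier H → Y.carrier} (he : Y.fig H e) : Z.fig H fun h => (d h).1 (e h) :=
  hd H (fun h => (h, e h)) ⟨F.isMor_id H, he⟩

/-- The arrows `p : P → X` and `q : P → Y` exhibit `P` as a product of `X` and `Y`: points of `P`
are pairs of a point of `X` and a point of `Y`, and figures of `P` are tested componentwise. -/
structure IsProduct {P : Space F} (p : P.Hom X) (q : P.Hom Y) : Prop where
  ext : ∀ ⦃z z' : P.carrier⦄, p z = p z' → q z = q z' → z = z'
  exists_eq : ∀ (x : X.carrier) (y : Y.carrier), ∃ z, p z = x ∧ q z = y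
  fig : ∀ ⦃H : F.Obj⦄ ⦃d : F.carrier H → P.carrier⦄,
    X.fig H (fun h => p (d h)) → Y.fig H (fun h => q (d h)) → P.fig H d

namespace IsProduct

variable {P : Space F} {p : P.Hom X} {q : P.Hom Y} (hP : IsProduct p q)
include hP

/-- The arrow into a product with given components. -/
noncomputable def lift (f : Z.Hom X) (g : Z.Hom Y) : Z.Hom P :=
  ⟨fun z => (hP.exists_eq (f z) (g z)).choose, fun H d hd =>
    hP.fig
      ((congrArg (X.fig H) (funext fun _ => (hP.exists_eq _ _).choose_spec.1)).mpr (f.2 H d hd))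
      ((congrArg (Y.fig H) (funext fun _ => (hP.exists_eq _ _).choose_spec.2)).mpr (g.2 H d hd))⟩

lemma fst_lift (f : Z.Hom X) (g : Z.Hom Y) (z : Z.carrier) : p (hP.lift f g z) = f z :=
  (hP.exists_eq (f z) (g z)).choose_spec.1

lemma snd_lift (f : Z.Hom X) (g : Z.Hom Y) (z : Z.carrier) : q (hP.lift f g z) = g z :=
  (hP.exists_eq (f z) (g z)).choose_spec.2

/-- The canonical map from the product `X × Y` to `P`. -/
noncomputable def pair : (X.prod Y).Hom P :=
  hP.lift ⟨Prod.fst, fun _ _ hd => hd.1⟩ ⟨Prod.snd, fun _ _ hd => hd.2⟩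

lemma fst_pair (x : X.carrier) (y : Y.carrier) : p (hP.pair (x, y)) = x :=
  hP.fst_lift (Z := X.prod Y) _ _ (x, y)

lemma snd_pair (x : X.carrier) (y : Y.carrier) : q (hP.pair (x, y)) = y :=
  hP.snd_lift (Z := X.prod Y) _ _ (x, y)

/-- The isomorphism `(Z^X)^Y ≅ Z^P` for a product `P` of `X` and `Y`. -/
noncomputable def expIso (Z : Space F) : (Y.exp (X.exp Z)).Iso (P.exp Z) where
  hom := curry ⟨fun z => (z.1.1 (q z.2)).1 (p z.2), fun _ _ hd =>
    fig_eval (fig_eval hd.1 (q.2 _ _ hd.2)) (p.2 _ _ hd.2)⟩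
  inv := curry (curry ⟨fun z => z.1.1.1 (hP.pair (z.2, z.1.2)), fun _ _ hd =>
    fig_eval hd.1.1 (hP.pair.2 _ _ ⟨hd.2, hd.1.2⟩)⟩)
  hom_inv f := Hom.ext fun _ => congrArg f.1 (hP.ext (hP.fst_pair _ _) (hP.snd_pair _ _))
  inv_hom f := Hom.ext fun y => Hom.ext fun x =>
    congrArg₂ (fun y' x' => (f.1 y').1 x') (hP.snd_pair x y) (hP.fst_pair x y)

end IsProduct

end Space

/-! ## The group `•ℝᵐ` -/

section Group

section NilPaths

variable {E : Type*} [NormedAddCommGroup E] {a b : ℝ → E}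

lemma NilP.add (ha : NilP a) (hb : NilP b) : NilP (fun t => a t + b t) := by
  refine (ha.prodMk hb).of_le (C := 2) (Eventually.of_forall fun t => ?_)
  calc ‖a t + b t - (a 0 + b 0)‖ = ‖(a t - a 0) + (b t - b 0)‖ := by rw [add_sub_add_comm]
    _ ≤ ‖a t - a 0‖ + ‖b t - b 0‖ := norm_add_le _ _
    _ ≤ 2 * ‖(a t - a 0, b t - b 0)‖ := by
      rw [two_mul]
      exact add_le_add (norm_fst_le (a t - a 0, b t - b 0)) (norm_snd_le (a t - a 0, b t - b 0))

lemma NilP.neg (ha : NilP a) : NilP (fun t => -a t) :=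
  ha.of_le (C := 1) (Eventually.of_forall fun t => by rw [neg_sub_neg, norm_sub_rev, one_mul])

lemma NilP.sub (ha : NilP a) (hb : NilP b) : NilP (fun t => a t - b t) := by
  simpa only [sub_eq_add_neg] using ha.add hb.neg

variable (E)

/-- The group of nilpotent paths in a normed space. -/
def nilPaths : AddSubgroup (ℝ → E) where
  carrier := {c | NilP c}
  add_mem' := NilP.add
  zero_mem' := NilP.const 0
  neg_mem' := NilP.neg

/-- The group of paths of size `o(t)` in a normed space. -/
def littleOPaths : AddSubgroup (ℝ → E) where
  carrier := {c | c =o[𝓝 0] fun t : ℝ => t}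
  add_mem' := IsLittleO.add
  zero_mem' := isLittleO_zero _ _
  neg_mem' := IsLittleO.neg_left

end NilPaths

variable (n : ℕ∞) [Fact (1 ≤ n)] (m : ℕ)

/-- Nilpotent paths in the `Cⁿ` space `ℝᵐ` are the nilpotent paths in the normed space `ℝᵐ`. -/
def nilpotentPathEquiv :
    NilpotentPath (R n m) ≃ nilPaths (Fin m → ℝ) where
  toFun x := ⟨fun t => (show (⊤ : TopologicalSpace.Opens (Fin m → ℝ)) from x.1 t).1,
    isNilpotentPath_iff.1 x.2⟩
  invFun c := ⟨fun t => ⟨c.1 t, trivial⟩, isNilpotentPath_iff.2 c.2⟩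

/-- The set `•ℝᵐ` is the quotient of the group of nilpotent paths by the paths of size `o(t)`. -/
def extEquiv : Ext (R n m) ≃
    nilPaths (Fin m → ℝ) ⧸ (littleOPaths (Fin m → ℝ)).addSubgroupOf (nilPaths (Fin m → ℝ)) :=
  Quotient.congr (nilpotentPathEquiv n m) fun x y => by
    rw [QuotientAddGroup.leftRel_apply, AddSubgroup.mem_addSubgroupOf, ← neg_mem_iff,
      ← NegMemClass.coe_neg, neg_add_rev, neg_neg, neg_add_eq_sub]
    exact Quotient.eq.symm.trans (mkR_eq_iff (n := n) (hc := (nilpotentPathEquiv n m x).2)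
      (hc' := (nilpotentPathEquiv n m y).2))

instance : AddCommGroup (Ext (R n m)) :=
  (extEquiv n m).addCommGroup

/-- The class of a nilpotent path, as a homomorphism of groups. -/
def mkRHom : nilPaths (Fin m → ℝ) →+ Ext (R n m) where
  toFun c := mkR n c.1 c.2
  map_zero' := rfl
  map_add' _ _ := rfl

end Group

/-! ## Arrows into `•ℝᵗ` -/

section RMor

variable {n : ℕ∞} {s t r : ℕ}

lemma exists_contDiffOn_eq {V : TopologicalSpace.Opens (Fin s → ℝ)}
    (h : (Space.bar (OR.of n V)).Hom (R n t)) : ∃ G : (Fin s → ℝ) → Fin t → ℝ,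
      ContDiffOn ℝ n G V ∧
      ∀ v : V, (show (⊤ : TopologicalSpace.Opens (Fin t → ℝ)) from h v).1 = G v := by
  let g : V → Fin t → ℝ := fun v => (show (⊤ : TopologicalSpace.Opens (Fin t → ℝ)) from h v).1
  have hg : ContMDiff 𝓘(ℝ, Fin s → ℝ) 𝓘(ℝ, Fin t → ℝ) n g :=
    contMDiff_subtypeVal_comp_iff.2 (h.2 (OR.of n V) id ((OR n).isMor_id _))
  have hG : ∀ v : V, Function.extend Subtype.val g 0 v.1 = g v :=
    fun v => Subtype.val_injective.extend_apply g _ v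
  refine ⟨Function.extend Subtype.val g 0, fun v hv => ContDiffAt.contDiffWithinAt ?_,
    fun v => (hG v).symm⟩
  rw [← contMDiffAt_iff_contDiffAt, ← contMDiffAt_subtype_iff (x := (⟨v, hv⟩ : V))]
  exact (congrArg (fun f => ContMDiffAt _ _ _ f _) (funext hG)).mpr (hg ⟨v, hv⟩)

lemma Ext.map_comp {X : CSpace.{u} n} {Y : CSpace.{v} n} {Z : CSpace n} (g : Y.Hom Z)
    (f : X.Hom Y) (z : Ext X) : Ext.map (g.comp f) z = Ext.map g (Ext.map f z) := by
  induction z using Quotient.inductionOn with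
  | h x => rfl

variable [Fact (1 ≤ n)]

lemma map_inclR_injective {V : TopologicalSpace.Opens (Fin s → ℝ)} :
    Function.Injective (Ext.map (inclR n V)) := by
  intro z w hzw
  obtain ⟨a, ha, haV, rfl⟩ := exists_mkW z
  obtain ⟨b, hb, hbV, rfl⟩ := exists_mkW w
  exact mkW_eq_iff.2 ((mkR_eq_iff (hc := ha) (hc' := hb)).1 hzw)

lemma exists_contDiffOn_map {V : TopologicalSpace.Opens (Fin s → ℝ)}
    (h : (Space.bar (OR.of n V)).Hom (R n t)) : ∃ G : (Fin s → ℝ) → Fin t → ℝ,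
      ContDiffOn ℝ n G V ∧ ∀ y c hc, Ext.map (inclR n V) y = mkR n c hc →
        ∃ hG : NilP (fun t => G (c t)), Ext.map h y = mkR n _ hG := by
  obtain ⟨G, hGd, hG⟩ := exists_contDiffOn_eq h
  have hGd' (v) (hv : v ∈ V) : ContDiffAt ℝ n G v := hGd.contDiffAt (V.2.mem_nhds hv)
  refine ⟨G, hGd, fun y c hc hy => ?_⟩
  have hcV : c 0 ∈ V := (mkR_mem_extOpen (hc := hc)).1 ⟨y, hy⟩
  obtain ⟨a, ha, haV, rfl⟩ := exists_mkW y
  obtain ⟨ha', e⟩ := map_mkW h (hc := ha) (h := haV)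
  have hac : (fun t => a t - c t) =o[𝓝 0] fun t : ℝ => t := (mkR_eq_iff (hc := ha)).1 hy
  refine ⟨hc.comp (hGd' _ hcV), e.trans ((mkR_eq_iff (hc := ha')).2 ?_)⟩
  exact (isLittleO_comp ha hc hac (hGd' _ (haV 0))).congr_left
    fun t => congrArg (· - G (c t)) (hG ⟨a t, haV t⟩).symm

variable {S : Set (Ext (R n s))}

/-- The arrows from `S ⊆ •ℝˢ` to the whole of `•ℝᵗ`, described by paths as in `IsPathMor`. -/
def IsRMor (f : S → Ext (R n t)) : Prop :=
  IsPathMor (T := univ) fun x => ⟨f x, trivial⟩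

lemma isSERMor_iff_isRMor {T : Set (Ext (R n t))} {f : S → T} :
    IsSERMor f ↔ IsRMor fun x => (f x).1 :=
  isSERMor_iff

namespace IsRMor

lemma comp {Q : Set (Ext (R n r))} {g : S → Ext (R n t)} (hg : IsRMor g) {f : Q → S}
    (hf : IsSERMor f) : IsRMor fun x => g (f x) :=
  isSERMor_iff_isRMor.1 ((isSERMor_iff_isRMor (f := fun x => (⟨g x, trivial⟩ : univ))).2 hg
    |>.comp hf)

lemma const (z : Ext (R n t)) : IsRMor fun _ : S => z :=
  isSERMor_iff_isRMor.1 (isSERMor_const S (⟨z, trivial⟩ : univ))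

lemma val (S : Set (Ext (R n s))) : IsRMor fun x : S => x.1 :=
  isSERMor_iff_isRMor.1 (isSERMor_id S)

lemma continuous {f : S → Ext (R n t)} (hf : IsRMor f) : Continuous f :=
  continuous_subtype_val.comp
    (isSERMor_iff_isRMor (f := fun x => (⟨f x, trivial⟩ : univ)).2 hf).continuous

lemma map {V : TopologicalSpace.Opens (Fin t → ℝ)} {y : S → Ext (Space.bar (OR.of n V))}
    (hy : IsRMor fun x => Ext.map (inclR n V) (y x)) (h : (Space.bar (OR.of n V)).Hom (R n r)) :
    IsRMor fun x => Ext.map h (y x) := by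
  obtain ⟨G, hGd, hG⟩ := exists_contDiffOn_map h
  intro b₀ hb₀ hS₀
  obtain ⟨P, _, _, _, a, O, A, ha, hO, hA, h0, hAy⟩ := hy b₀ hb₀ hS₀
  have mem_V (b hb) (hS : mkR n b hb ∈ S) (h : (a 0, b 0) ∈ O) : A (a 0, b 0) ∈ V := by
    obtain ⟨hc, e⟩ := hAy b hb hS h
    exact (mkR_mem_extOpen (hc := hc)).1 ⟨_, e⟩
  refine ⟨P, inferInstance, inferInstance, inferInstance, a, O ∩ A ⁻¹' V, fun z => G (A z), ha,
    hA.continuousOn.isOpen_inter_preimage hO V.2,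
    hGd.comp (hA.mono inter_subset_left) fun _ h => h.2, ⟨h0, mem_V b₀ hb₀ hS₀ h0⟩, ?_⟩
  intro b hb hS hbO
  obtain ⟨hc, e⟩ := hAy b hb hS hbO.1
  exact hG _ _ hc e

lemma map₂ {p q : ℕ} {f : S → Ext (R n p)} {g : S → Ext (R n q)} (hf : IsRMor f) (hg : IsRMor g)
    {G : (Fin p → ℝ) × (Fin q → ℝ) → Fin t → ℝ} (hG : ContDiff ℝ n G) {k : S → Ext (R n t)}
    (hk : ∀ x α hα β hβ, f x = mkR n α hα → g x = mkR n β hβ →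
      ∃ h, k x = mkR n (fun t => G (α t, β t)) h) : IsRMor k := by
  intro b₀ hb₀ hS₀
  obtain ⟨P, _, _, _, a, O, A, ha, hO, hA, h0, hAf⟩ := hf b₀ hb₀ hS₀
  obtain ⟨P', _, _, _, a', O', A', ha', hO', hA', h0', hAg⟩ := hg b₀ hb₀ hS₀
  let π : (P × P') × (Fin s → ℝ) → P × (Fin s → ℝ) := fun z => (z.1.1, z.2)
  let π' : (P × P') × (Fin s → ℝ) → P' × (Fin s → ℝ) := fun z => (z.1.2, z.2)
  have hπ : ContDiff ℝ n π := by fun_prop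
  have hπ' : ContDiff ℝ n π' := by fun_prop
  refine ⟨P × P', inferInstance, inferInstance, inferInstance, fun t => (a t, a' t),
    π ⁻¹' O ∩ π' ⁻¹' O', fun z => G (A (π z), A' (π' z)), ha.prodMk ha',
    (hO.preimage hπ.continuous).inter (hO'.preimage hπ'.continuous), ?_, ⟨h0, h0'⟩, ?_⟩
  · exact hG.comp_contDiffOn ((hA.comp hπ.contDiffOn fun _ h => h.1).prodMk
      (hA'.comp hπ'.contDiffOn fun _ h => h.2))
  · intro b hb hS hmem
    obtain ⟨hc, e⟩ := hAf b hb hS hmem.1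
    obtain ⟨hc', e'⟩ := hAg b hb hS hmem.2
    exact hk _ _ hc _ hc' e e'

lemma add {f g : S → Ext (R n t)} (hf : IsRMor f) (hg : IsRMor g) : IsRMor fun x => f x + g x :=
  hf.map₂ hg (G := fun z => z.1 + z.2) (by fun_prop) fun x α hα β hβ hfx hgx =>
    ⟨hα.add hβ, hfx ▸ hgx ▸ ((mkRHom n t).map_add ⟨α, hα⟩ ⟨β, hβ⟩).symm⟩

lemma sub {f g : S → Ext (R n t)} (hf : IsRMor f) (hg : IsRMor g) : IsRMor fun x => f x - g x :=
  hf.map₂ hg (G := fun z => z.1 - z.2) (by fun_prop) fun x α hα β hβ hfx hgx =>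
    ⟨hα.sub hβ, hfx ▸ hgx ▸ ((mkRHom n t).map_sub ⟨α, hα⟩ ⟨β, hβ⟩).symm⟩

lemma sum {ι : Type*} (I : Finset ι) {f : ι → S → Ext (R n t)} (hf : ∀ i, IsRMor (f i)) :
    IsRMor fun x => ∑ i ∈ I, f i x := by
  rw [← Finset.sum_fn]
  exact Finset.sum_induction f IsRMor (fun _ _ => add) (const 0) fun i _ => hf i

end IsRMor

section ProdOpen

variable {m k : ℕ} {U : TopologicalSpace.Opens (Fin m → ℝ)} {V : TopologicalSpace.Opens (Fin k → ℝ)}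

lemma map_inclR_eq_append {z : Ext (Space.bar (OR.of n (prodOpen U V)))} {a : ℝ → Fin m → ℝ}
    {b : ℝ → Fin k → ℝ} {ha : NilP a} {hb : NilP b} (hza : Ext.map (projL n U V) z = mkR n a ha)
    (hzb : Ext.map (projR n U V) z = mkR n b hb) :
    Ext.map (inclR n (prodOpen U V)) z = mkR n _ (ha.append n hb) := by
  obtain ⟨c, hc, hcU, rfl⟩ := exists_mkW z
  obtain ⟨hl, el⟩ := map_mkW (projL n U V) (hc := hc) (h := hcU)
  obtain ⟨hr, er⟩ := map_mkW (projR n U V) (hc := hc) (h := hcU)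
  have la : ∀ i, (fun t => c t (Fin.castAdd k i) - a t i) =o[𝓝 0] fun t : ℝ => t :=
    isLittleO_pi.1 ((mkR_eq_iff (hc := hl)).1 (el.symm.trans hza))
  have lb : ∀ i, (fun t => c t (Fin.natAdd m i) - b t i) =o[𝓝 0] fun t : ℝ => t :=
    isLittleO_pi.1 ((mkR_eq_iff (hc := hr)).1 (er.symm.trans hzb))
  refine (mkR_eq_iff (hc := hc)).2 (isLittleO_pi.2 fun i => Fin.addCases (fun i => ?_)
    (fun i => ?_) i)
  · simpa only [Pi.sub_apply, Fin.append_left] using la i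
  · simpa only [Pi.sub_apply, Fin.append_right] using lb i

lemma ext_prodOpen_ext {z z' : Ext (Space.bar (OR.of n (prodOpen U V)))}
    (hl : Ext.map (projL n U V) z = Ext.map (projL n U V) z')
    (hr : Ext.map (projR n U V) z = Ext.map (projR n U V) z') : z = z' := by
  obtain ⟨a, ha, ea⟩ := exists_mkR (Ext.map (projL n U V) z')
  obtain ⟨b, hb, eb⟩ := exists_mkR (Ext.map (projR n U V) z')
  exact map_inclR_injective ((map_inclR_eq_append (hl.trans ea) (hr.trans eb)).trans
    (map_inclR_eq_append ea eb).symm)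

lemma IsRMor.of_proj {w : S → Ext (Space.bar (OR.of n (prodOpen U V)))}
    (hl : IsRMor fun x => Ext.map (projL n U V) (w x))
    (hr : IsRMor fun x => Ext.map (projR n U V) (w x)) :
    IsRMor fun x => Ext.map (inclR n (prodOpen U V)) (w x) :=
  hl.map₂ hr contDiff_append fun _ _ hα _ hβ ea eb =>
    ⟨hα.append n hβ, map_inclR_eq_append ea eb⟩

end ProdOpen

section Restriction

variable (H : SERObj n) (U : TopologicalSpace.Opens H.2)

/-- The inclusion of an open subset of a subset of an extended real space. -/
def inclS : (Subtype.val '' (U : Set H.2) : Set (Ext (R n H.1))) → H.2 :=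
  (SER n).incl H U

lemma isOpenEmbedding_inclS : IsOpenEmbedding (inclS H U) :=
  (SER n).incl_isOpenEmbedding H U

lemma range_inclS : range (inclS H U) = U :=
  (SER n).range_incl H U

lemma isSERMor_inclS : IsSERMor (inclS H U) :=
  (SER n).isMor_incl H U

variable {H} in
lemma isRMor_of_local {f : H.2 → Ext (R n t)}
    (hf : ∀ x : H.2, ∃ U : TopologicalSpace.Opens H.2, x ∈ U ∧ IsRMor fun y => f (inclS H U y)) :
    IsRMor f :=
  isSERMor_iff_isRMor.1 ((SER n).isMor_sheaf (H := H) (K := (⟨t, univ⟩ : SERObj n))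
    (f := fun x => ⟨f x, trivial⟩) fun x => by
      obtain ⟨U, hx, hU⟩ := hf x
      exact ⟨U, hx, isSERMor_iff_isRMor.2 hU⟩)

variable {H} in
lemma isOpen_of_local {A : Set H.2}
    (hA : ∀ x, ∃ U : TopologicalSpace.Opens H.2, x ∈ U ∧ IsOpen (inclS H U ⁻¹' A)) : IsOpen A := by
  refine isOpen_iff_mem_nhds.2 fun x hx => ?_
  obtain ⟨U, hxU, hU⟩ := hA x
  obtain ⟨y, rfl⟩ := (range_inclS H U).superset hxU
  exact mem_of_superset ((isOpenEmbedding_inclS H U).isOpenMap.image_mem_nhds (hU.mem_nhds hx))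
    (image_preimage_subset _ _)

end Restriction

end RMor

/-! ## Charts of `Cⁿ` spaces -/

section Charts

variable {n : ℕ∞} {X : CSpace.{u} n}

lemma Ext.mk_congr {x y : NilpotentPath X} (h : ∀ᶠ t in 𝓝 0, x.1 t = y.1 t) :
    Ext.mk x = Ext.mk y :=
  Quotient.sound fun _ _ _ c _ => ⟨by rw [h.self_of_nhds], fun _ =>
    (isLittleO_zero (fun t : ℝ => t) (𝓝 0)).congr'
      (h.mono fun t ht => (sub_eq_zero.2 (congrArg c ht)).symm) .rfl⟩

lemma Ext.mk_zero_mem_iff {x y : NilpotentPath X} (h : Ext.mk x = Ext.mk y)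
    {U : Set X.carrier} {k : ℕ} {K : TopologicalSpace.Opens (Fin k → ℝ)}
    {c : X.carrier → Fin k → ℝ} (hc : IsObservable X U K c) : x.1 0 ∈ U ↔ y.1 0 ∈ U :=
  ((Quotient.exact h) U k K c hc).1

/-- A chart of a `Cⁿ` space: an isomorphism `param` from an open set `W` of some `ℝᵈ` to an open
subspace, with inverse `coo`. -/
structure CChart (X : CSpace.{u} n) where
  dim : ℕ
  W : TopologicalSpace.Opens (Fin dim → ℝ)
  param : (Space.bar (OR.of n W)).Hom X
  isOpen_range : IsOpen[X.topology] (range param.1)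
  coo : (X.sub (range param.1)).Hom (Space.bar (OR.of n W))
  coo_param : ∀ w : W, coo (⟨param w, w, rfl⟩ : range param.1) = w

/-- A `Cⁿ` space is locally Euclidean if it is covered by the domains of its charts. -/
def LocEuclidean (X : CSpace.{u} n) : Prop :=
  ∀ x, ∃ c : CChart X, x ∈ range c.param.1

namespace CChart

variable (c : CChart X)

lemma param_coo (x : range c.param.1) : c.param (c.coo x) = x.1 := by
  obtain ⟨_, w, rfl⟩ := x
  exact congrArg c.param.1 (c.coo_param w)

/-- The map `A → W` corresponding to an arrow `A → X` into the domain of the chart. -/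
def lift {A : CSpace.{v} n} (h : A.Hom X) (hh : ∀ a, h a ∈ range c.param.1) :
    A.Hom (Space.bar (OR.of n c.W)) :=
  ⟨fun a => c.coo (⟨h a, hh a⟩ : range c.param.1),
    fun H d hd => c.coo.2 H (fun x => ⟨h (d x), hh (d x)⟩) (h.2 H d hd)⟩

lemma param_lift {A : CSpace.{v} n} (h : A.Hom X) (hh : ∀ a, h a ∈ range c.param.1)
    (a : A.carrier) : c.param (c.lift h hh a) = h a :=
  c.param_coo _

open Classical in
/-- The coordinate map of a chart, extended by `0` outside of its domain. -/
noncomputable def obs (x : X.carrier) : Fin c.dim → ℝ :=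
  if hx : x ∈ range c.param.1 then (show c.W from c.coo (⟨x, hx⟩ : range c.param.1)).1 else 0

lemma obs_param (w : c.W) : c.obs (c.param w) = w :=
  (dif_pos ⟨w, rfl⟩).trans (congrArg Subtype.val (c.coo_param w))

lemma isObservable_obs : IsObservable X (range c.param.1) c.W c.obs :=
  ⟨c.isOpen_range, c.coo, fun x => dif_pos x.2⟩

/-- The points of `•X` in the domain of the chart. -/
def dom : Set (Ext X) :=
  range (Ext.map c.param)

/-- The preimage of the domain of a chart under a figure of type `V`, as an open subset of `ℝᵐ`. -/
def preDom {m : ℕ} {V : TopologicalSpace.Opens (Fin m → ℝ)} (h : (Space.bar (OR.of n V)).Hom X) :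
    TopologicalSpace.Opens (Fin m → ℝ) :=
  openImage V ⟨h.1 ⁻¹' range c.param.1, isOpen_of_topology (h.isOpen_preimage c.isOpen_range)⟩

variable [Fact (1 ≤ n)]

lemma map_param_injective : Function.Injective (Ext.map c.param) := by
  intro z w e
  obtain ⟨a, ha, haW, rfl⟩ := exists_mkW z
  obtain ⟨b, hb, hbW, rfl⟩ := exists_mkW w
  refine mkW_eq_iff.2 (((Quotient.exact e _ _ _ _ c.isObservable_obs).2 ⟨_, rfl⟩).congr_left
    fun t => ?_)
  exact congrArg₂ (· - ·) (c.obs_param ⟨a t, haW t⟩) (c.obs_param ⟨b t, hbW t⟩)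

lemma mk_mem_dom {x : NilpotentPath X} : Ext.mk x ∈ c.dom ↔ x.1 0 ∈ range c.param.1 := by
  classical
  constructor
  · rintro ⟨w, hw⟩
    induction w using Quotient.inductionOn with
    | h w => exact (Ext.mk_zero_mem_iff hw c.isObservable_obs).1 ⟨_, rfl⟩
  · intro h0
    have hx : ∀ᶠ t in 𝓝 0, x.1 t ∈ range c.param.1 :=
      letI := X.topology
      x.2.1 (c.isOpen_range.mem_nhds h0)
    let w (t : ℝ) : c.W := if h : x.1 t ∈ range c.param.1 then h.choose else h0.choose
    have hw : ∀ᶠ t in 𝓝 0, c.param (w t) = x.1 t := by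
      filter_upwards [hx] with t ht
      rw [show w t = ht.choose from dif_pos ht]
      exact ht.choose_spec
    have w_nilP : NilP fun t => (w t : Fin c.dim → ℝ) := by
      refine NilP.congr (x.2.2 _ _ _ _ c.isObservable_obs h0) ?_
      filter_upwards [hw] with t ht
      rw [← ht, c.obs_param]
    exact ⟨Ext.mk ⟨w, isNilpotentPath_iff.2 w_nilP⟩, Ext.mk_congr hw⟩

lemma exists_mem_dom (hX : LocEuclidean X) (z : Ext X) : ∃ c : CChart X, z ∈ c.dom := by
  induction z using Quotient.inductionOn with
  | h x =>
    obtain ⟨c, hc⟩ := hX (x.1 0)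
    exact ⟨c, c.mk_mem_dom.2 hc⟩

open Classical in
/-- The coordinates of a point of `•X` in the domain of a chart, and `0` outside of the domain. -/
noncomputable def coord (z : Ext X) : Ext (R n c.dim) :=
  if h : z ∈ c.dom then Ext.map (inclR n c.W) h.choose else 0

lemma coord_map_param (w : Ext (Space.bar (OR.of n c.W))) :
    c.coord (Ext.map c.param w) = Ext.map (inclR n c.W) w :=
  have h : Ext.map c.param w ∈ c.dom := ⟨w, rfl⟩
  (dif_pos h).trans (congrArg _ (c.map_param_injective h.choose_spec))

lemma coord_mem {z : Ext X} (hz : z ∈ c.dom) : c.coord z ∈ extOpen n c.W := by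
  obtain ⟨w, rfl⟩ := hz
  exact ⟨w, (c.coord_map_param w).symm⟩

lemma coord_injOn : InjOn c.coord c.dom := by
  rintro _ ⟨w, rfl⟩ _ ⟨w', rfl⟩ e
  rw [coord_map_param, coord_map_param] at e
  rw [map_inclR_injective e]

section Preimage

variable {m : ℕ} {V : TopologicalSpace.Opens (Fin m → ℝ)} (h : (Space.bar (OR.of n V)).Hom X)

lemma map_mem_dom_iff (y : Ext (Space.bar (OR.of n V))) :
    Ext.map h y ∈ c.dom ↔ Ext.map (inclR n V) y ∈ extOpen n (c.preDom h) := by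
  obtain ⟨b, hb, hbV, rfl⟩ := exists_mkW y
  refine c.mk_mem_dom.trans (Iff.trans ?_ (mkR_mem_extOpen (hc := hb)).symm)
  exact ⟨fun h0 => ⟨⟨b 0, hbV 0⟩, h0, rfl⟩, fun ⟨v, hv, e⟩ =>
    (congrArg (h.1 · ∈ range c.param.1) (Subtype.ext e : v = ⟨b 0, hbV 0⟩)).mp hv⟩

lemma exists_coord_map_eq : ∃ k : (Space.bar (OR.of n (c.preDom h))).Hom (R n c.dim),
    ∀ y : Ext (Space.bar (OR.of n V)), Ext.map h y ∈ c.dom →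
      ∃ y', Ext.map (inclR n (c.preDom h)) y' = Ext.map (inclR n V) y ∧
        c.coord (Ext.map h y) = Ext.map k y' := by
  let ι : (Space.bar (OR.of n (c.preDom h))).Hom (Space.bar (OR.of n V)) :=
    ⟨openImageIncl V _, fun _ _ hd => (OR n).isMor_comp ((OR n).isMor_incl (OR.of n V) _) hd⟩
  have hι (v) : h (ι v) ∈ range c.param.1 := by
    obtain ⟨_, v, hv, rfl⟩ := v
    exact hv
  let ψ := c.lift (h.comp ι) hι
  refine ⟨(inclR n c.W).comp ψ, fun y hy => ?_⟩
  obtain ⟨y', hy'⟩ := (c.map_mem_dom_iff h y).1 hy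
  have ι_y' : Ext.map ι y' = y := map_inclR_injective ((Ext.map_comp _ ι y').symm.trans hy')
  have param_ψ : Ext.map c.param (Ext.map ψ y') = Ext.map h y := by
    rw [← ι_y', ← Ext.map_comp, ← Ext.map_comp]
    exact congrArg (Ext.map · y') (Space.Hom.ext (c.param_lift (h.comp ι) hι))
  exact ⟨y', hy', by rw [← param_ψ, coord_map_param, Ext.map_comp]⟩

end Preimage

end CChart

end Charts

/-! ## Figures of extended spaces -/

section Figures

variable {n : ℕ∞}

lemma Ext.map_id {X : CSpace.{u} n} (z : Ext X) : Ext.map (Space.Hom.id X) z = z := by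
  induction z using Quotient.inductionOn with
  | h x => rfl

variable [Fact (1 ≤ n)] {X : CSpace.{u} n} {Z : Set (Ext X)} {H : SERObj n}

lemma extInduced_fig_of_isRMor {δ : H.2 → Z} {m : ℕ} {V : TopologicalSpace.Opens (Fin m → ℝ)}
    (h : (Space.bar (OR.of n V)).Hom X) {y : H.2 → Ext (Space.bar (OR.of n V))}
    (hy : IsRMor fun x => Ext.map (inclR n V) (y x)) (hδ : ∀ x, (δ x).1 = Ext.map h (y x)) :
    (extInduced X Z).fig H δ := fun _ =>
  let T : Set (Ext (R n m)) := range fun x => Ext.map (inclR n V) (y x)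
  ⟨⊤, trivial, (⟨m, T⟩ : SERObj n), fun w : T => δ w.2.choose,
    .inr ⟨V, h, fun w => ⟨y w.2.choose, w.2.choose_spec, hδ _⟩⟩,
    fun x => (⟨_, inclS H ⊤ x, rfl⟩ : T),
    isSERMor_iff_isRMor.2 (hy.comp (isSERMor_inclS H ⊤)), funext fun x => Subtype.ext (by
      have hT : ∃ x', Ext.map (inclR n V) (y x') = Ext.map (inclR n V) (y (inclS H ⊤ x)) :=
        ⟨_, rfl⟩
      exact (hδ _).trans ((congrArg _ (map_inclR_injective hT.choose_spec)).symm.trans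
        (hδ _).symm))⟩

lemma extInduced_fig_local {δ : H.2 → Z} (hδ : (extInduced X Z).fig H δ) (x₀ : H.2) :
    ∃ U : TopologicalSpace.Opens H.2, x₀ ∈ U ∧ ((∃ z, ∀ x, δ (inclS H U x) = z) ∨
      ∃ (m : ℕ) (V : TopologicalSpace.Opens (Fin m → ℝ)) (h : (Space.bar (OR.of n V)).Hom X)
        (y : _ → Ext (Space.bar (OR.of n V))), IsRMor (fun x => Ext.map (inclR n V) (y x)) ∧
        ∀ x, (δ (inclS H U x)).1 = Ext.map h (y x)) := by
  obtain ⟨U, hx₀, T, d, hd, f, hf, e⟩ := hδ x₀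
  refine ⟨U, hx₀, hd.imp (fun ⟨z, hz⟩ => ⟨z, fun x => (congrFun e x).trans (hz _)⟩) ?_⟩
  rintro ⟨V, h, hV⟩
  choose y hy hdy using hV
  exact ⟨_, V, h, fun x => y (f x),
    (congrArg IsRMor (funext fun x => hy (f x))).mpr (isSERMor_iff_isRMor.1 hf),
    fun x => (congrArg Subtype.val (congrFun e x)).trans (hdy _)⟩

/-- The arrow `•f : •X → •Y` of an arrow `f : X → Y`. -/
def Ext.mapHom {Y : CSpace.{v} n} (f : X.Hom Y) : (extSpace X).Hom (extSpace Y) where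
  val z := (Ext.map f z.1).toSpace
  property H δ hδ := (extSpace Y).fig_sheaf H _ fun x₀ => by
    obtain ⟨U, hx₀, ⟨z, hz⟩ | ⟨m, V, h, y, hy, hU⟩⟩ := extInduced_fig_local hδ x₀
    · refine ⟨U, hx₀, ?_⟩
      convert (extSpace Y).fig_const ((SER n).restr H U) (Ext.map f z.1).toSpace using 1
      exact funext fun x =>
        congrArg (fun w : (extSpace X).carrier => (Ext.map f w.1).toSpace) (hz x)
    · exact ⟨U, hx₀, extInduced_fig_of_isRMor (H := (SER n).restr H U) (f.comp h) hy fun x =>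
        (congrArg (Ext.map f) (hU x)).trans (Ext.map_comp _ _ _).symm⟩

namespace CChart

variable (c : CChart X)

lemma isOpen_preimage_dom {δ : H.2 → (extSpace X).carrier} (hδ : (extSpace X).fig H δ) :
    IsOpen {x | (δ x).1 ∈ c.dom} := by
  refine isOpen_of_local fun x₀ => ?_
  obtain ⟨U, hx₀, ⟨z, hz⟩ | ⟨m, V, h, y, hy, hU⟩⟩ := extInduced_fig_local hδ x₀
  · refine ⟨U, hx₀, ?_⟩
    simp only [preimage_ofPred_eq, hz]
    exact isOpen_const
  · refine ⟨U, hx₀, ?_⟩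
    simp only [preimage_ofPred_eq, hU, c.map_mem_dom_iff]
    exact (isOpen_ext_iff.2 ⟨_, rfl⟩).preimage hy.continuous

lemma fig_iff {δ : H.2 → (extSpace X).carrier} (hdom : ∀ x, (δ x).1 ∈ c.dom) :
    (extSpace X).fig H δ ↔ IsRMor fun x => c.coord (δ x).1 := by
  constructor
  · refine fun hδ => isRMor_of_local fun x₀ => ?_
    obtain ⟨U, hx₀, ⟨z, hz⟩ | ⟨m, V, h, y, hy, hU⟩⟩ := extInduced_fig_local hδ x₀
    · refine ⟨U, hx₀, ?_⟩
      simp only [hz]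
      exact .const _
    · obtain ⟨k, hk⟩ := c.exists_coord_map_eq h
      choose y' hy' hky' using fun x => hk (y x) (hU x ▸ hdom (inclS H U x))
      refine ⟨U, hx₀, ?_⟩
      simp only [hU, hky']
      exact IsRMor.map ((congrArg IsRMor (funext hy')).mpr hy) k
  · intro hδ
    choose w hw using hdom
    refine extInduced_fig_of_isRMor c.param (y := w) ?_ fun x => (hw x).symm
    simpa only [← hw, coord_map_param] using hδ

end CChart

lemma LocEuclidean.fig_of_local (hX : LocEuclidean X) {δ₀ : H.2 → (extSpace X).carrier}
    (h₀ : (extSpace X).fig H δ₀) {Y : ECSpace.{v} n} {δ : H.2 → Y.carrier}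
    (hδ : ∀ (c : CChart X) (J : SERObj n) (i : J.2 → H.2), IsSERMor i →
      (∀ x, (δ₀ (i x)).1 ∈ c.dom) → Y.fig J fun x => δ (i x)) : Y.fig H δ := by
  refine Y.fig_sheaf H δ fun x₀ => ?_
  obtain ⟨c, hc⟩ := CChart.exists_mem_dom hX (δ₀ x₀).1
  let U : TopologicalSpace.Opens H.2 := ⟨_, c.isOpen_preimage_dom h₀⟩
  refine ⟨U, hc, hδ c ((SER n).restr H U) (inclS H U) (isSERMor_inclS H U)
    fun x => ?_⟩
  exact (range_inclS H U).subset (mem_range_self x)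

lemma D_fig_iff {δ : H.2 → firstOrder n} : (D n).fig H δ ↔ IsRMor fun x => (δ x).1 := by
  constructor
  · refine fun hδ => isRMor_of_local fun x₀ => ?_
    obtain ⟨U, hx₀, ⟨z, hz⟩ | ⟨m, V, h, y, hy, hU⟩⟩ := extInduced_fig_local hδ x₀
    · refine ⟨U, hx₀, ?_⟩
      simp only [hz]
      exact .const _
    · refine ⟨U, hx₀, ?_⟩
      simp only [hU]
      exact hy.map h
  · intro hδ
    refine extInduced_fig_of_isRMor (Space.Hom.id (R n 1)) (y := fun x => (δ x).1) ?_
      fun x => (Ext.map_id _).symm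
    exact (congrArg IsRMor (funext fun x => Ext.map_id (δ x).1)).mpr hδ

end Figures

/-! ## First order infinitesimals -/

section IsFirstOrder

variable {E : Type*} [NormedAddCommGroup E]

/-- A path is of first order if it is `O(t)` at `0`, so that it represents a vector with entries
in `D`. -/
def IsFirstOrder (b : ℝ → E) : Prop :=
  b =O[𝓝 0] fun t : ℝ => t

namespace IsFirstOrder

variable {b : ℝ → E}

lemma zero : IsFirstOrder fun _ : ℝ => (0 : E) :=
  isBigO_zero _ _

lemma eq_zero (hb : IsFirstOrder b) : b 0 = 0 := by
  obtain ⟨C, hC⟩ := hb.bound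
  simpa using hC.self_of_nhds

lemma tendsto (hb : IsFirstOrder b) : Tendsto b (𝓝 0) (𝓝 0) :=
  hb.trans_tendsto tendsto_id

lemma nilP (hb : IsFirstOrder b) : NilP b := by
  refine ⟨2, ?_⟩
  simp only [hb.eq_zero, sub_zero]
  exact (hb.norm_left.pow 2).trans_isLittleO (by simpa using isLittleO_pow_pow one_lt_two)

lemma clm {F : Type*} [NormedAddCommGroup F] [NormedSpace ℝ E] [NormedSpace ℝ F]
    (hb : IsFirstOrder b) (ℓ : E →L[ℝ] F) : IsFirstOrder fun t => ℓ (b t) :=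
  (ℓ.isBigO_comp b _).trans hb

lemma single {ι : Type*} [Fintype ι] [DecidableEq ι] {b : ℝ → ι → ℝ} (hb : IsFirstOrder b) (i : ι) :
    IsFirstOrder fun t => (Pi.single i (b t i) : ι → ℝ) :=
  hb.clm ((ContinuousLinearMap.single ℝ (fun _ => ℝ) i).comp (.proj i))

lemma coord {ι : Type*} [Fintype ι] {b : ℝ → ι → ℝ} (hb : IsFirstOrder b) (i : ι) :
    IsFirstOrder fun t (_ : Fin 1) => b t i :=
  isBigO_pi.2 fun _ => isBigO_pi.1 hb i

end IsFirstOrder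

lemma isLittleO_sub_sub_of_isFirstOrder {P F : Type*} [NormedAddCommGroup P] [NormedSpace ℝ P]
    [NormedSpace ℝ E] [NormedAddCommGroup F] [NormedSpace ℝ F] {G : P × E → F} {a : ℝ → P}
    {L : P × E →L[ℝ] F} (hG : HasStrictFDerivAt G L (a 0, 0)) (ha : ContinuousAt a 0)
    {v : ℝ → E} (hv : IsFirstOrder v) :
    (fun t => G (a t, v t) - G (a t, 0) - L (0, v t)) =o[𝓝 0] fun t : ℝ => t := by
  have h_tendsto : Tendsto (fun t => ((a t, v t), (a t, (0 : E)))) (𝓝 0) (𝓝 ((a 0, 0), (a 0, 0))) :=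
    (ha.prodMk_nhds hv.tendsto).prodMk_nhds (ha.prodMk_nhds tendsto_const_nhds)
  have h_sub (t : ℝ) : (a t, v t) - (a t, (0 : E)) = (0, v t) := by simp
  refine ((hG.isLittleO.comp_tendsto h_tendsto).trans_isBigO ?_).congr_left fun t => ?_
  · simp only [Function.comp_def, h_sub]
    exact (isBigO_zero _ _).prod_left hv
  · simp only [Function.comp_apply, h_sub]

end IsFirstOrder

section InfPow

variable {n : ℕ∞} [Fact (1 ≤ n)] {k m : ℕ}

lemma mem_firstOrder_iff {z : Ext (R n 1)} :
    z ∈ firstOrder n ↔ ∃ b hb, z = mkR n b hb ∧ IsFirstOrder b := by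
  constructor
  · rintro ⟨c, rfl, hc⟩
    exact ⟨_, isNilpotentPath_iff.1 c.2, rfl, hc⟩
  · rintro ⟨b, hb, rfl, hO⟩
    exact ⟨_, rfl, hO⟩

variable (n k) in
/-- The set `Dᵏ`, as a subset of `•ℝᵏ`. -/
def infPow : Set (Ext (R n k)) :=
  {z | ∃ b hb, z = mkR n b hb ∧ IsFirstOrder b}

variable (n) in
/-- The element of `Dᵏ` represented by a path of first order. -/
def mkInf {b : ℝ → Fin k → ℝ} (hb : IsFirstOrder b) : infPow n k :=
  ⟨mkR n b hb.nilP, b, _, rfl, hb⟩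

lemma IsRMor.exists_affine {f : infPow n k → Ext (R n m)} (hf : IsRMor f) :
    ∃ ℓ : (Fin k → ℝ) →L[ℝ] Fin m → ℝ, ∀ {b} (hb : IsFirstOrder b),
      f (mkInf n hb) = f (mkInf n .zero) + mkRHom n m ⟨_, (hb.clm ℓ).nilP⟩ := by
  obtain ⟨P, _, _, _, a, O, G, ha, hO, hG, h0, hfG⟩ := hf (fun _ => 0) (.const 0) (mkInf n .zero).2
  have f_mkInf {b} (hb : IsFirstOrder b) :
      ∃ hc : NilP (fun t => G (a t, b t)), f (mkInf n hb) = mkR n _ hc :=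
    hfG b hb.nilP (mkInf n hb).2 (by rwa [hb.eq_zero])
  have n_ne : (n : WithTop ℕ∞) ≠ 0 := by
    have : n ≠ 0 := (zero_lt_one.trans_le (Fact.out : 1 ≤ n)).ne'
    exact_mod_cast this
  have hstrict : HasStrictFDerivAt G (fderiv ℝ G (a 0, 0)) (a 0, 0) :=
    (hG.contDiffAt (hO.mem_nhds h0)).hasStrictFDerivAt n_ne
  refine ⟨(fderiv ℝ G (a 0, 0)).comp (.inr ℝ P (Fin k → ℝ)), fun {b} hb => ?_⟩
  obtain ⟨hc₀, e₀⟩ := f_mkInf .zero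
  obtain ⟨hc, e⟩ := f_mkInf hb
  rw [e, e₀, ← sub_eq_iff_eq_add']
  refine ((mkRHom n m).map_sub ⟨_, hc⟩ ⟨_, hc₀⟩).symm.trans ?_
  refine (mkR_eq_iff (hc := hc.sub hc₀) (hc' := (hb.clm _).nilP)).2 ?_
  exact isLittleO_sub_sub_of_isFirstOrder hstrict ha.continuousAt hb

lemma IsRMor.eq_add_sum {f : infPow n k → Ext (R n m)} (hf : IsRMor f) {b : ℝ → Fin k → ℝ}
    (hb : IsFirstOrder b) : f (mkInf n hb) = f (mkInf n .zero) +
      ∑ i, (f (mkInf n (hb.single i)) - f (mkInf n .zero)) := by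
  obtain ⟨ℓ, hℓ⟩ := hf.exists_affine
  simp only [hℓ hb, hℓ (hb.single _), add_sub_cancel_left, ← map_sum]
  refine congrArg (fun c => f (mkInf n .zero) + mkRHom n m c) (Subtype.ext (funext fun t => ?_))
  rw [AddSubgroup.val_finsetSum, Finset.sum_apply, ← map_sum, Finset.univ_sum_single]

lemma mem_of_isOpen_infPow {O : Set (infPow n k)} (hO : IsOpen O) (h0 : mkInf n .zero ∈ O)
    (z : infPow n k) : z ∈ O := by
  obtain ⟨V, rfl⟩ := isOpen_subtype_iff.1 hO
  obtain ⟨_, b, hb, rfl, hb'⟩ := z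
  refine (mkR_mem_extOpen (hc := hb)).2 ?_
  rw [hb'.eq_zero]
  exact (mkR_mem_extOpen (hc := (IsFirstOrder.zero (E := Fin k → ℝ)).nilP)).1 h0

variable (n) in
/-- The `i`-th coordinate map `ℝᵏ → ℝ`. -/
def evR (i : Fin k) : (R n k).Hom (R n 1) :=
  OR.hom (W := ⊤) (K := ⊤) (fun w => ⟨fun _ => w.1 i, trivial⟩)
    (ContMDiff.comp (g := fun (w : Fin k → ℝ) (_ : Fin 1) => w i)
      (ContDiff.contMDiff (by fun_prop)) contMDiff_subtype_val)

/-- The map from the subset `Dᵏ` of `•ℝᵏ` to the power `Dᵏ`. -/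
def infCoord (z : infPow n k) : ((D n).pow k).carrier := fun i =>
  show firstOrder n from ⟨Ext.map (evR n i) z.1, by
    obtain ⟨_, b, hb, rfl, hO⟩ := z
    exact mem_firstOrder_iff.2 ⟨_, (hO.coord i).nilP, rfl, hO.coord i⟩⟩

lemma infCoord_mkInf {b : ℝ → Fin k → ℝ} (hb : IsFirstOrder b) (i : Fin k) :
    (infCoord (mkInf n hb) i).1 = mkR n _ (hb.coord i).nilP :=
  rfl

lemma fig_infCoord : ((D n).pow k).fig (⟨k, infPow n k⟩ : SERObj n) infCoord := fun i =>
  D_fig_iff.2 (IsRMor.map (y := Subtype.val)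
    ((congrArg IsRMor (funext fun x => Ext.map_id x.1)).mpr (.val _)) (evR n i))

lemma infCoord_single {b : ℝ → Fin k → ℝ} (hb : IsFirstOrder b) (i : Fin k) :
    infCoord (mkInf n (hb.single i)) =
      Function.update (fun _ => D.zero n) i (infCoord (mkInf n hb) i) := by
  funext j
  refine Subtype.ext ((infCoord_mkInf _ j).trans ?_)
  rcases eq_or_ne j i with rfl | h
  · rw [Function.update_self, infCoord_mkInf]
    exact mkR_congr (.of_forall fun t => funext fun _ => Pi.single_eq_same _ _)
  · rw [Function.update_of_ne h]
    exact mkR_congr (hc' := NilP.const 0)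
      (.of_forall fun t => funext fun _ => Pi.single_eq_of_ne h _)

lemma exists_mkInf (d : ((D n).pow k).carrier) :
    ∃ (b : ℝ → Fin k → ℝ) (hb : IsFirstOrder b), infCoord (mkInf n hb) = d := by
  choose β hβ e hO using fun i => mem_firstOrder_iff.1 (show firstOrder n from d i).2
  have hb : IsFirstOrder fun t i => β i t 0 := isBigO_pi.2 fun i => isBigO_pi.1 (hO i) 0
  refine ⟨_, hb, funext fun i => Subtype.ext ((infCoord_mkInf hb i).trans (.trans ?_ (e i).symm))⟩
  exact mkR_congr (.of_forall fun t => funext fun j => congrArg (β i t) (Subsingleton.elim 0 j))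

end InfPow

/-! ## Infinitesimal linearity -/

section AxisSum

variable {ι T G : Type*} [AddCommGroup G]

/-- The map `Tⁱ → G` that extends maps `f i : T → G` with the common value `z` at a base point of
`T` by adding up their increments: the only affine extension of the `f i`. -/
def axisSum [Fintype ι] (z : G) (f : ι → T → G) (d : ι → T) : G :=
  z + ∑ i, (f i (d i) - z)

variable [Fintype ι]

lemma axisSum_base {z : G} {f : ι → T → G} {o : T} (ho : ∀ i, f i o = z) :
    axisSum z f (fun _ => o) = z := by
  simp [axisSum, ho]

lemma axisSum_update [DecidableEq ι] {z : G} {f : ι → T → G} {o : T} (ho : ∀ i, f i o = z) (i : ι)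
    (d : T) : axisSum z f (Function.update (fun _ => o) i d) = f i d := by
  rw [axisSum, Finset.sum_eq_single_of_mem i (Finset.mem_univ i), Function.update_self,
    add_sub_cancel]
  intro j _ hj
  rw [Function.update_of_ne hj, ho, sub_self]

end AxisSum

section InfLinear

variable {n : ℕ∞} [Fact (1 ≤ n)] {X : CSpace.{u} n} {k : ℕ}

lemma IsRMor.axisSum {H : SERObj n} {T : Type*} {m : ℕ} {z : H.2 → Ext (R n m)}
    {f : H.2 → Fin k → T → Ext (R n m)} {d : H.2 → Fin k → T} (hz : IsRMor z)
    (hf : ∀ i, IsRMor fun x => f x i (d x i)) : IsRMor fun x => axisSum (z x) (f x) (d x) :=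
  hz.add (.sum _ fun i => (hf i).sub hz)

namespace CChart

variable (c : CChart X)

lemma mem_dom_of_hom (p : ((D n).pow k).Hom (extSpace X))
    (h0 : (p fun _ => D.zero n).1 ∈ c.dom) (d : ((D n).pow k).carrier) : (p d).1 ∈ c.dom := by
  obtain ⟨b, hb, rfl⟩ := exists_mkInf d
  exact mem_of_isOpen_infPow (c.isOpen_preimage_dom (p.2 _ _ fig_infCoord)) h0 (mkInf n hb)

lemma mem_dom_of_tangent (t : (D n).Hom (extSpace X)) (h0 : (t (D.zero n)).1 ∈ c.dom)
    (d : (D n).carrier) : (t d).1 ∈ c.dom :=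
  c.mem_dom_of_hom (k := 1) (t.comp ⟨fun v => v 0, fun _ _ hd => hd 0⟩) h0 fun _ => d

lemma coord_hom_eq (p : ((D n).pow k).Hom (extSpace X))
    (h0 : (p fun _ => D.zero n).1 ∈ c.dom) (d : ((D n).pow k).carrier) :
    c.coord (p d).1 = axisSum (c.coord (p fun _ => D.zero n).1)
      (fun i e => c.coord (p (Function.update (fun _ => D.zero n) i e)).1) d := by
  obtain ⟨b, hb, rfl⟩ := exists_mkInf d
  have coord_p : IsRMor fun z => c.coord (p (infCoord z)).1 :=
    (c.fig_iff fun _ => c.mem_dom_of_hom p h0 _).1 (p.2 _ _ fig_infCoord)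
  refine (coord_p.eq_add_sum hb).trans (congrArg (_ + ·) (Finset.sum_congr rfl fun i _ => ?_))
  exact congrArg (fun v => c.coord (p v).1 - _) (infCoord_single hb i)

lemma exists_hom_pow_of_coord {Q : ((D n).pow k).carrier → Ext (R n c.dim)}
    (hQ : ∀ {H : SERObj n} {δ : H.2 → _}, ((D n).pow k).fig H δ → IsRMor fun x => Q (δ x))
    (h0 : Q (fun _ => D.zero n) ∈ extOpen n c.W) :
    ∃ p : ((D n).pow k).Hom (extSpace X), ∀ d, (p d).1 ∈ c.dom ∧ c.coord (p d).1 = Q d := by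
  have Q_mem (d) : Q d ∈ extOpen n c.W := by
    obtain ⟨b, hb, rfl⟩ := exists_mkInf d
    exact mem_of_isOpen_infPow ((isOpen_ext_iff.2 ⟨_, rfl⟩).preimage (hQ fig_infCoord).continuous)
      h0 (mkInf n hb)
  choose w hw using Q_mem
  refine ⟨⟨fun d => (Ext.map c.param (w d)).toSpace, fun H δ hδ =>
    extInduced_fig_of_isRMor c.param (y := fun x => w (δ x)) ?_ fun _ => rfl⟩, fun d =>
    ⟨⟨w d, rfl⟩, (c.coord_map_param _).trans (hw d)⟩⟩
  simpa only [hw] using hQ hδ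

end CChart

lemma hom_pow_ext (hX : LocEuclidean X) (hk : 0 < k) {p q : ((D n).pow k).Hom (extSpace X)}
    (h : ∀ i d, p (Function.update (fun _ => D.zero n) i d) =
      q (Function.update (fun _ => D.zero n) i d)) : p = q := by
  have h0 : p (fun _ => D.zero n) = q fun _ => D.zero n := by
    simpa only [Function.update_eq_self] using h ⟨0, hk⟩ (D.zero n)
  obtain ⟨c, hc⟩ := CChart.exists_mem_dom hX (p fun _ => D.zero n).1
  have hc' : (q fun _ => D.zero n).1 ∈ c.dom := h0 ▸ hc
  refine Space.Hom.ext fun d => Subtype.ext ?_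
  refine c.coord_injOn (c.mem_dom_of_hom p hc d) (c.mem_dom_of_hom q hc' d) ?_
  rw [c.coord_hom_eq p hc, c.coord_hom_eq q hc']
  simp only [h, h0]

lemma exists_hom_pow (hX : LocEuclidean X) {x : (extSpace X).carrier}
    (t : Fin k → (D n).Hom (extSpace X)) (ht : ∀ i, t i (D.zero n) = x) :
    ∃ p : ((D n).pow k).Hom (extSpace X), ∀ i d,
      p (Function.update (fun _ => D.zero n) i d) = t i d := by
  obtain ⟨c, hc⟩ := CChart.exists_mem_dom hX x.1
  have htc (i d) : (t i d).1 ∈ c.dom := c.mem_dom_of_tangent (t i) ((ht i).symm ▸ hc) d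
  have coord_zero (i) : c.coord (t i (D.zero n)).1 = c.coord x.1 := by rw [ht]
  obtain ⟨p, hp⟩ := c.exists_hom_pow_of_coord
    (Q := axisSum (c.coord x.1) fun i e => c.coord (t i e).1)
    (fun hδ => .axisSum (.const _) fun i => (c.fig_iff fun _ => htc i _).1 ((t i).2 _ _ (hδ i)))
    (by rw [axisSum_base coord_zero]; exact c.coord_mem hc)
  refine ⟨p, fun i d => Subtype.ext (c.coord_injOn (hp _).1 (htc i d) ?_)⟩
  exact (hp _).2.trans (axisSum_update coord_zero i d)

lemma fig_hom_pow_apply (hX : LocEuclidean X) {H : SERObj n}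
    {P : H.2 → ((D n).pow k).Hom (extSpace X)} {v : H.2 → ((D n).pow k).carrier}
    (h₀ : (extSpace X).fig H fun x => P x fun _ => D.zero n)
    (hP : ∀ i, (extSpace X).fig H fun x => P x (Function.update (fun _ => D.zero n) i (v x i))) :
    (extSpace X).fig H fun x => P x (v x) := by
  refine hX.fig_of_local h₀ fun c J i hi hdom => ?_
  have hc (x d) : (P (i x) d).1 ∈ c.dom := c.mem_dom_of_hom _ (hdom x) d
  refine (c.fig_iff fun x => hc x _).2 ?_
  simp only [fun x => c.coord_hom_eq (P (i x)) (hdom x)]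
  exact .axisSum ((c.fig_iff hdom).1 ((extSpace X).fig_comp hi h₀)) fun j =>
    (c.fig_iff fun x => hc x _).1 ((extSpace X).fig_comp hi (hP j))

theorem infLinear_extSpace (hX : LocEuclidean X) : InfLinear (extSpace X) := by
  intro k hk x t ht
  obtain ⟨p, hp⟩ := exists_hom_pow hX t ht
  exact ⟨p, hp, fun q hq => hom_pow_ext hX (by omega) fun i d => (hq i d).trans (hp i d).symm⟩

theorem infLinear_exp (hX : LocEuclidean X) (A : ECSpace.{v} n) :
    InfLinear (A.exp (extSpace X)) := by
  intro k hk f t ht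
  have ht' (a i) : (Space.evalHom (extSpace X) a).comp (t i) (D.zero n) = f.1 a :=
    congrArg (fun g : A.Hom (extSpace X) => g.1 a) (ht i)
  choose p hp using fun a =>
    exists_hom_pow hX (fun i => (Space.evalHom (extSpace X) a).comp (t i)) (ht' a)
  have hp0 (a) : p a (fun _ => D.zero n) = f.1 a := by
    simpa only [Function.update_eq_self, ht'] using hp a ⟨0, by omega⟩ (D.zero n)
  have isHom_p : (((D n).pow k).prod A).IsHom (extSpace X) fun z => p z.2 z.1 := by
    rintro H δ ⟨hα, he⟩
    refine fig_hom_pow_apply hX (P := fun x => p (δ x).2) ?_ fun i => ?_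
    · simp only [hp0]
      exact f.2 H _ he
    · simp only [hp]
      exact Space.fig_eval ((t i).2 H _ (hα i)) he
  refine ⟨Space.curry ⟨_, isHom_p⟩, fun i d => Space.Hom.ext fun a => hp a i d, fun q hq => ?_⟩
  have eval_q (a) : (Space.evalHom (extSpace X) a).comp q = p a :=
    hom_pow_ext hX (by omega) fun i d =>
      (congrArg (fun g : A.Hom (extSpace X) => g.1 a) (hq i d)).trans (hp a i d).symm
  exact Space.Hom.ext fun d => Space.Hom.ext fun a =>
    congrArg (fun g : ((D n).pow k).Hom (extSpace X) => g.1 d) (eval_q a)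

lemma InfLinear.of_iso {Y : ECSpace.{u} n} {Z : ECSpace.{v} n} (φ : Y.Iso Z) (hZ : InfLinear Z) :
    InfLinear Y := by
  intro k hk x t ht
  obtain ⟨p, hp, huniq⟩ := hZ k hk (φ.hom x) (fun i => φ.hom.comp (t i))
    fun i => congrArg φ.hom.1 (ht i)
  refine ⟨φ.inv.comp p, fun i d => ?_, fun q hq => Space.Hom.ext fun d => ?_⟩
  · exact (congrArg φ.inv.1 (hp i d)).trans (φ.inv_hom _)
  · rw [← huniq (φ.hom.comp q) fun i d => congrArg φ.hom.1 (hq i d)]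
    exact (φ.inv_hom _).symm

end InfLinear

/-! ## Charts of manifolds and of products -/

section Products

variable {n : ℕ∞}

namespace Man

variable (M : Man.{u} n) (x : M.carrier)

/-- The coordinates identifying the model space of a manifold with `ℝᵈ`. -/
noncomputable def modelEquiv : M.E ≃L[ℝ] (Fin (Module.finrank ℝ M.E) → ℝ) :=
  (Module.finBasis ℝ M.E).equivFunL

/-- The target of the chart of a manifold at a point, as an open subset of `ℝᵈ`. -/
noncomputable def chartTarget : TopologicalSpace.Opens (Fin (Module.finrank ℝ M.E) → ℝ) :=
  ⟨M.modelEquiv.symm ⁻¹' (chartAt M.E x).target,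
    (chartAt M.E x).open_target.preimage M.modelEquiv.symm.continuous⟩

/-- The inverse of the chart of a manifold at a point, as an arrow of `Cⁿ`. -/
noncomputable def chartParam :
    (Space.bar (OR.of n (M.chartTarget x))).Hom M.toCSpace :=
  ⟨fun w : M.chartTarget x => (chartAt M.E x).symm (M.modelEquiv.symm w), fun _ d hd =>
    (contMDiffOn_chart_symm (I := 𝓘(ℝ, M.E))).comp_contMDiff
      (M.modelEquiv.symm.contDiff.contMDiff.comp (contMDiff_subtypeVal_comp_iff.2 hd))
      fun y => (d y).2⟩

lemma modelEquiv_mem_chartTarget {y : M.carrier} (hy : y ∈ (chartAt M.E x).source) :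
    M.modelEquiv (chartAt M.E x y) ∈ M.chartTarget x := by
  change M.modelEquiv.symm (M.modelEquiv (chartAt M.E x y)) ∈ (chartAt M.E x).target
  rw [M.modelEquiv.symm_apply_apply]
  exact (chartAt M.E x).map_source hy

lemma range_chartParam : range (M.chartParam x).1 = (chartAt M.E x).source := by
  refine Subset.antisymm (range_subset_iff.2 fun w => (chartAt M.E x).map_target w.2)
    fun y hy => ⟨⟨_, M.modelEquiv_mem_chartTarget x hy⟩, ?_⟩
  exact (congrArg (chartAt M.E x).symm (M.modelEquiv.symm_apply_apply _)).trans
    ((chartAt M.E x).left_inv hy)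

lemma mem_chart_source_of_mem_range {y : M.carrier} (hy : y ∈ range (M.chartParam x).1) :
    y ∈ (chartAt M.E x).source :=
  (M.range_chartParam x).subset hy

/-- The chart of a manifold at a point, as a chart of the corresponding `Cⁿ` space. -/
noncomputable def chart : CChart M.toCSpace where
  dim := Module.finrank ℝ M.E
  W := M.chartTarget x
  param := M.chartParam x
  isOpen_range _ _ hd := M.range_chartParam x ▸
    (chartAt M.E x).open_source.preimage (ContMDiff.continuous hd)
  coo := ⟨fun y => ⟨M.modelEquiv (chartAt M.E x y.1),
      M.modelEquiv_mem_chartTarget x (M.mem_chart_source_of_mem_range x y.2)⟩,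
    fun _ d hd => contMDiff_subtypeVal_comp_iff.1 (M.modelEquiv.contDiff.contMDiff.comp
      ((contMDiffOn_chart (I := 𝓘(ℝ, M.E))).comp_contMDiff hd
        fun y => M.mem_chart_source_of_mem_range x (d y).2))⟩
  coo_param w := Subtype.ext ((congrArg M.modelEquiv ((chartAt M.E x).right_inv w.2)).trans
    (M.modelEquiv.apply_symm_apply _))

lemma locEuclidean : LocEuclidean M.toCSpace := fun x : M.carrier =>
  ⟨M.chart x, (M.range_chartParam x).superset (mem_chart_source M.E x)⟩

lemma isProduct (N : Man.{u} n) : Space.IsProduct (M.fst N) (M.snd N) where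
  ext _ _ h h' := Prod.ext h h'
  exists_eq x y := ⟨(x, y), rfl, rfl⟩
  fig (H : ORObj) (d : H.2 → M.carrier × N.carrier) h h' := by
    have hd : ContMDiff 𝓘(ℝ, Fin H.1 → ℝ) (𝓘(ℝ, M.E).prod 𝓘(ℝ, N.E)) n d :=
      ContMDiff.prodMk h h'
    rw [← modelWithCornersSelf_prod] at hd
    exact hd

end Man

section ProdOpen

variable {m k : ℕ} (U : TopologicalSpace.Opens (Fin m → ℝ)) (V : TopologicalSpace.Opens (Fin k → ℝ))

/-- The projection `U × V → U`. -/
def prodFst (n : ℕ∞) : (Space.bar (OR.of n (prodOpen U V))).Hom (Space.bar (OR.of n U)) :=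
  OR.hom (fun w => ⟨fun i => w.1 (Fin.castAdd k i), w.2.1⟩)
    (ContMDiff.comp (g := fun (w : Fin (m + k) → ℝ) (i : Fin m) => w (Fin.castAdd k i))
      (ContDiff.contMDiff (by fun_prop)) contMDiff_subtype_val)

/-- The projection `U × V → V`. -/
def prodSnd (n : ℕ∞) : (Space.bar (OR.of n (prodOpen U V))).Hom (Space.bar (OR.of n V)) :=
  OR.hom (fun w => ⟨fun i => w.1 (Fin.natAdd m i), w.2.2⟩)
    (ContMDiff.comp (g := fun (w : Fin (m + k) → ℝ) (i : Fin k) => w (Fin.natAdd m i))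
      (ContDiff.contMDiff (by fun_prop)) contMDiff_subtype_val)

variable {U V}

lemma append_mem_prodOpen {u : Fin m → ℝ} {v : Fin k → ℝ} (hu : u ∈ U) (hv : v ∈ V) :
    Fin.append u v ∈ prodOpen U V := by
  refine ⟨?_, ?_⟩
  · simpa only [Fin.append_left] using hu
  · simpa only [Fin.append_right] using hv

lemma isProduct_prodOpen : Space.IsProduct (prodFst U V n) (prodSnd U V n) where
  ext w w' h h' := Subtype.ext (funext fun i => Fin.addCases
    (congrFun (congrArg Subtype.val h)) (congrFun (congrArg Subtype.val h')) i)
  exists_eq u v := ⟨⟨Fin.append u.1 v.1, append_mem_prodOpen u.2 v.2⟩,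
    Subtype.ext (funext fun i => Fin.append_left u.1 v.1 i),
    Subtype.ext (funext fun i => Fin.append_right u.1 v.1 i)⟩
  fig (H : ORObj) (d : H.2 → prodOpen U V) h h' := by
    have hU : ContMDiff 𝓘(ℝ, Fin H.1 → ℝ) 𝓘(ℝ, Fin m → ℝ) n fun x i => (d x).1 (Fin.castAdd k i) :=
      contMDiff_subtypeVal_comp_iff.2 h
    have hV : ContMDiff 𝓘(ℝ, Fin H.1 → ℝ) 𝓘(ℝ, Fin k → ℝ) n fun x i => (d x).1 (Fin.natAdd m i) :=
      contMDiff_subtypeVal_comp_iff.2 h'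
    exact contMDiff_subtypeVal_comp_iff.1 (contMDiff_pi_space.2
      (Fin.addCases (contMDiff_pi_space.1 hU) (contMDiff_pi_space.1 hV)))

variable [Fact (1 ≤ n)]

lemma exists_ext_prodOpen (z : Ext (Space.bar (OR.of n U))) (w : Ext (Space.bar (OR.of n V))) :
    ∃ y, Ext.map (prodFst U V n) y = z ∧ Ext.map (prodSnd U V n) y = w := by
  obtain ⟨a, ha, haU, rfl⟩ := exists_mkW z
  obtain ⟨b, hb, hbV, rfl⟩ := exists_mkW w
  refine ⟨mkW n _ _ (ha.append n hb) fun t => append_mem_prodOpen (haU t) (hbV t), ?_, ?_⟩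
  · exact Ext.mk_congr (.of_forall fun t => Subtype.ext (funext fun i => Fin.append_left _ _ i))
  · exact Ext.mk_congr (.of_forall fun t => Subtype.ext (funext fun i => Fin.append_right _ _ i))

end ProdOpen

namespace CChart

variable {X : CSpace.{u} n} {Y : CSpace.{v} n} {P : CSpace n} {p : P.Hom X} {q : P.Hom Y}
  (hP : Space.IsProduct p q) (c : CChart X) (c' : CChart Y)

/-- The product of the parametrisations of two charts. -/
noncomputable def prodParam : (Space.bar (OR.of n (prodOpen c.W c'.W))).Hom P :=
  hP.lift (c.param.comp (prodFst c.W c'.W n)) (c'.param.comp (prodSnd c.W c'.W n))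

lemma fst_prodParam (w : prodOpen c.W c'.W) :
    p (c.prodParam hP c' w) = c.param (prodFst c.W c'.W n w) :=
  hP.fst_lift (c.param.comp (prodFst c.W c'.W n)) (c'.param.comp (prodSnd c.W c'.W n)) w

lemma snd_prodParam (w : prodOpen c.W c'.W) :
    q (c.prodParam hP c' w) = c'.param (prodSnd c.W c'.W n w) :=
  hP.snd_lift (c.param.comp (prodFst c.W c'.W n)) (c'.param.comp (prodSnd c.W c'.W n)) w

lemma range_prodParam :
    range (c.prodParam hP c').1 = p.1 ⁻¹' range c.param.1 ∩ q.1 ⁻¹' range c'.param.1 := by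
  refine Subset.antisymm (range_subset_iff.2 fun w =>
    ⟨⟨_, (c.fst_prodParam hP c' w).symm⟩, ⟨_, (c.snd_prodParam hP c' w).symm⟩⟩) ?_
  rintro z ⟨⟨w, hw⟩, ⟨w', hw'⟩⟩
  obtain ⟨v, rfl, rfl⟩ := isProduct_prodOpen.exists_eq w w'
  exact ⟨v, hP.ext ((c.fst_prodParam hP c' v).trans hw) ((c.snd_prodParam hP c' v).trans hw')⟩

/-- The product of two charts, as a chart of a product of `Cⁿ` spaces. -/
noncomputable def prod : CChart P where
  dim := c.dim + c'.dim
  W := prodOpen c.W c'.W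
  param := c.prodParam hP c'
  isOpen_range := by
    let := P.topology
    rw [range_prodParam]
    exact (p.isOpen_preimage c.isOpen_range).inter (q.isOpen_preimage c'.isOpen_range)
  coo :=
    let incl : (P.sub (range (c.prodParam hP c').1)).Hom P := ⟨Subtype.val, fun _ _ hd => hd⟩
    isProduct_prodOpen.lift
      (c.lift (p.comp incl) fun z => ((c.range_prodParam hP c').subset z.2).1)
      (c'.lift (q.comp incl) fun z => ((c.range_prodParam hP c').subset z.2).2)
  coo_param w := isProduct_prodOpen.ext
    ((isProduct_prodOpen.fst_lift _ _ _).trans <|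
      (congrArg c.coo.1 (Subtype.ext (c.fst_prodParam hP c' w))).trans (c.coo_param _))
    ((isProduct_prodOpen.snd_lift _ _ _).trans <|
      (congrArg c'.coo.1 (Subtype.ext (c.snd_prodParam hP c' w))).trans (c'.coo_param _))

lemma map_fst_prodParam (y : Ext (Space.bar (OR.of n (prodOpen c.W c'.W)))) :
    Ext.map p (Ext.map (c.prodParam hP c') y) =
      Ext.map c.param (Ext.map (prodFst c.W c'.W n) y) := by
  rw [← Ext.map_comp, ← Ext.map_comp]
  exact congrArg (Ext.map · y) (Space.Hom.ext (c.fst_prodParam hP c'))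

lemma map_snd_prodParam (y : Ext (Space.bar (OR.of n (prodOpen c.W c'.W)))) :
    Ext.map q (Ext.map (c.prodParam hP c') y) =
      Ext.map c'.param (Ext.map (prodSnd c.W c'.W n) y) := by
  rw [← Ext.map_comp, ← Ext.map_comp]
  exact congrArg (Ext.map · y) (Space.Hom.ext (c.snd_prodParam hP c'))

variable [Fact (1 ≤ n)]

lemma exists_map_prodParam_eq {z : Ext P} (h : Ext.map p z ∈ c.dom) (h' : Ext.map q z ∈ c'.dom) :
    ∃ y, Ext.map (c.prodParam hP c') y = z := by
  induction z using Quotient.inductionOn with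
  | h x => exact (c.prod hP c').mk_mem_dom.2 ((c.range_prodParam hP c').superset
      ⟨c.mk_mem_dom.1 h, c'.mk_mem_dom.1 h'⟩)

lemma coord_map_fst (y : Ext (Space.bar (OR.of n (prodOpen c.W c'.W)))) :
    c.coord (Ext.map p (Ext.map (c.prodParam hP c') y)) = Ext.map (projL n c.W c'.W) y := by
  rw [map_fst_prodParam, coord_map_param, ← Ext.map_comp]
  rfl

lemma coord_map_snd (y : Ext (Space.bar (OR.of n (prodOpen c.W c'.W)))) :
    c'.coord (Ext.map q (Ext.map (c.prodParam hP c') y)) = Ext.map (projR n c.W c'.W) y := by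
  rw [map_snd_prodParam, coord_map_param, ← Ext.map_comp]
  rfl

include hP in
lemma fig_of_fig_fst_snd {H : SERObj n} {δ : H.2 → (extSpace P).carrier}
    (h : (extSpace X).fig H fun x => Ext.mapHom p (δ x))
    (h' : (extSpace Y).fig H fun x => Ext.mapHom q (δ x))
    (hc : ∀ x, Ext.map p (δ x).1 ∈ c.dom) (hc' : ∀ x, Ext.map q (δ x).1 ∈ c'.dom) :
    (extSpace P).fig H δ := by
  choose y hy using fun x => c.exists_map_prodParam_eq hP c' (hc x) (hc' x)
  have hl : IsRMor fun x => c.coord (Ext.map p (δ x).1) := (c.fig_iff hc).1 h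
  have hr : IsRMor fun x => c'.coord (Ext.map q (δ x).1) := (c'.fig_iff hc').1 h'
  simp only [← hy, coord_map_fst, coord_map_snd] at hl hr
  exact extInduced_fig_of_isRMor (c.prodParam hP c') (hl.of_proj hr) fun x => (hy x).symm

end CChart

theorem isProduct_extSpace [Fact (1 ≤ n)] {X : CSpace.{u} n} {Y : CSpace.{v} n} {P : CSpace n}
    {p : P.Hom X} {q : P.Hom Y} (hX : LocEuclidean X) (hY : LocEuclidean Y)
    (hP : Space.IsProduct p q) : Space.IsProduct (Ext.mapHom p) (Ext.mapHom q) where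
  ext z z' h h' := by
    obtain ⟨c, hc⟩ := CChart.exists_mem_dom hX (Ext.map p z.1)
    obtain ⟨c', hc'⟩ := CChart.exists_mem_dom hY (Ext.map q z.1)
    have e : Ext.map p z.1 = Ext.map p z'.1 := congrArg Subtype.val h
    have e' : Ext.map q z.1 = Ext.map q z'.1 := congrArg Subtype.val h'
    obtain ⟨y, hy⟩ := c.exists_map_prodParam_eq hP c' hc hc'
    obtain ⟨y', hy'⟩ := c.exists_map_prodParam_eq hP c' (e ▸ hc) (e' ▸ hc')
    have eq_y : y = y' := ext_prodOpen_ext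
      (by rw [← c.coord_map_fst hP c', ← c.coord_map_fst hP c', hy, hy', e])
      (by rw [← c.coord_map_snd hP c', ← c.coord_map_snd hP c', hy, hy', e'])
    exact Subtype.ext (by rw [← hy, ← hy', eq_y])
  exists_eq x y := by
    obtain ⟨c, w, hw⟩ := CChart.exists_mem_dom hX x.1
    obtain ⟨c', w', hw'⟩ := CChart.exists_mem_dom hY y.1
    obtain ⟨v, rfl, rfl⟩ := exists_ext_prodOpen w w'
    exact ⟨(Ext.map (c.prodParam hP c') v).toSpace,
      Subtype.ext ((c.map_fst_prodParam hP c' v).trans hw),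
      Subtype.ext ((c.map_snd_prodParam hP c' v).trans hw')⟩
  fig H δ h h' := by
    refine hX.fig_of_local h fun c J i hi hc => ?_
    refine hY.fig_of_local ((extSpace Y).fig_comp hi h') fun c' J' i' hi' hc' => ?_
    exact c.fig_of_fig_fst_snd hP c'
      ((extSpace X).fig_comp hi' ((extSpace X).fig_comp hi h))
      ((extSpace Y).fig_comp hi' ((extSpace Y).fig_comp hi h')) (fun x => hc (i' x)) hc'

end Products

section Main

variable {n : ℕ∞} [Fact (1 ≤ n)]

lemma exists_iso_iterExp (L : List (Man.{u} n)) : ∀ (A : ECSpace.{u} n) (M : Man.{u} n),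
    ∃ Φ : (iterExp A (M :: L)).Iso ((M.listProd L).ext.exp A),
      ∀ F z, (Φ.hom F).1 z.toSpace = evalIter A M L F z := by
  induction L with
  | nil => exact fun A M => ⟨Space.Iso.refl (M.ext.exp A), fun _ _ => rfl⟩
  | cons N L ih =>
    intro A M
    obtain ⟨Φ, hΦ⟩ := ih (M.ext.exp A) N
    have hP := isProduct_extSpace M.locEuclidean (N.listProd L).locEuclidean
      (M.isProduct (N.listProd L))
    refine ⟨Φ.trans (hP.expIso A), fun F z => ?_⟩
    exact congrArg (fun g : M.ext.Hom A => g.1 (Ext.map (M.fst (N.listProd L)) z).toSpace)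
      (hΦ F (Ext.map (M.snd (N.listProd L)) z))

theorem mainTheorem3_general {X : CSpace.{u} n} (hX : LocEuclidean X) :
    InfLinear (extSpace X) ∧
    ∀ (M : Man.{u} n) (L : List (Man.{u} n)),
      (∃ Φ : (iterExp (extSpace X) (M :: L)).Iso ((M.listProd L).ext.exp (extSpace X)),
        ∀ F z, (Φ.hom F).1 z.toSpace = evalIter (extSpace X) M L F z) ∧
      InfLinear (iterExp (extSpace X) (M :: L)) ∧
      InfLinear ((M.listProd L).ext.exp (extSpace X)) := by
  refine ⟨infLinear_extSpace hX, fun M L => ?_⟩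
  obtain ⟨Φ, hΦ⟩ := exists_iso_iterExp L (extSpace X) M
  have hexp : InfLinear ((M.listProd L).ext.exp (extSpace X)) := infLinear_exp hX _
  exact ⟨⟨Φ, hΦ⟩, InfLinear.of_iso Φ hexp, hexp⟩

end Main

end IDG

open IDG in
theorem mainTheorem3 (n : ℕ∞) [Fact (1 ≤ n)] :
    (∀ M : Man.{u} n, InfLinear M.ext) ∧
    ∀ (M₁ M₂ : Man.{u} n) (L : List (Man.{u} n)),
      (∃ Φ : (iterExp M₁.ext (M₂ :: L)).Iso ((M₂.listProd L).ext.exp M₁.ext),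
        ∀ (F : (iterExp M₁.ext (M₂ :: L)).carrier) (z : Ext (M₂.listProd L).toCSpace),
          (Φ.hom F).1 z.toSpace = evalIter M₁.ext M₂ L F z) ∧
      InfLinear (iterExp M₁.ext (M₂ :: L)) ∧
      InfLinear ((M₂.listProd L).ext.exp M₁.ext) :=
  ⟨fun M => (mainTheorem3_general M.locEuclidean).1,
    fun M₁ => (mainTheorem3_general M₁.locEuclidean).2⟩
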